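/- Let $\mathbb{D}$ be the open unit disk of $\mathbb{C}$. For $d\ge 0$, a Blaschke product of degree $d$ is a function on $\mathbb{D}$ of the form $B(z)=e^{i\theta}\prod_{j=1}^d\frac{z-a_j}{1-\overline{a_j}z}$ with $\theta\in\mathbb{R}$ and $a_1,\dots,a_d\in\mathbb{D}$ (for $d=0$, a constant of modulus $1$). For a holomorphic $f:\mathbb{D}\to\mathbb{D}$ and $\sigma\in\partial\mathbb{D}$, the boundary dilation coefficient of $f$ at $\sigma$ is $$\beta_f(\sigma)=\inf_{\tau\in\partial\mathbb{D}}\ \sup_{z\in\mathbb{D}}\left\{\frac{|\tau-f(z)|^2}{1-|f(z)|^2}\bigg/\frac{|\sigma-z|^2}{1-|z|^2}\right\}\in[0,+\infty],$$ and $f(\sigma)$ denotes the non-tangential limit of $f$ at $\sigma$, that is, the limit of $f(z)$ as $z\to\sigma$ within $\{z\in\mathbb{D}: |\sigma-z|<M(1-|z|)\}$ for every $M>1$ (it exists whenever $\beta_f(\sigma)<+\infty$). **Theorem.** Let $k\ge 1$ and let $f:\mathbb{D}\to\mathbb{D}$ be holomorphic and not a Blaschke product of degree at most $k$. Assume that there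 is $z_0\in\mathbb{D}$ with $f(z_0)=z_0$ and $f'(z_0)=\dots=f^{(k-1)}(z_0)=0$ (no condition on derivatives if $k=1$). Let $n\ge 0$ and let $\sigma_1,\dots,\sigma_n\in\partial\mathbb{D}$ be distinct points such that $\beta_f(\sigma_j)<+\infty$ and $$f(\sigma_j)=\frac{\left(\frac{\sigma_j-z_0}{1-\overline{z_0}\sigma_j}\right)^k+z_0}{1+\overline{z_0}\left(\frac{\sigma_j-z_0}{1-\overline{z_0}\sigma_j}\right)^k}\qquad (j=1,\dots,n).$$ Then $$\sum_{j=1}^{n}\frac{1}{\left(1+2\,\mathrm{Re}\,\frac{(f(\sigma_j)-\sigma_j)\overline{z_0}}{|f(\sigma_j)-z_0|^2}\right)\beta_f(\sigma_j)-k}\ \le\ \frac{1-\left|\frac{f^{(k)}(z_0)}{k!}(1-|z_0|^2)^{k-1}\right|^2}{\left|1-\frac{f^{(k)}(z_0)}{k!}(1-|z_0|^2)^{k-1}\right|^2},$$ where every denominator on the left is positive and the denominator on the right is nonzero. Equality holds if and only if $f$ is a Blaschke product of degree $n+k$. -/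

import Mathlib

open scoped ENNReal

/-- Blaschke products of degree `d` on the unit disk:
`B(z) = e^{iθ} ∏_{j=1}^d (z - a_j) / (1 - conj a_j * z)` for `|z| < 1`, with `θ` real and all `a_j`
in the disk. For `d = 0` these are the constants of modulus one. -/
def IsBlaschkeProduct (d : ℕ) (B : ℂ → ℂ) : Prop :=
  ∃ (θ : ℝ) (a : Fin d → ℂ), (∀ j, a j ∈ Metric.ball (0 : ℂ) 1) ∧
    ∀ z ∈ Metric.ball (0 : ℂ) 1,
      B z = Complex.exp (θ * Complex.I) *
        ∏ j, (z - a j) / (1 - (starRingEnd ℂ) (a j) * z)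

/-- The coefficient `β_f(σ, τ)`, the supremum over the unit disk of
`(|τ - f z|² / (1 - |f z|²)) / (|σ - z|² / (1 - |z|²))`. -/
noncomputable def dilationCoeffAt (f : ℂ → ℂ) (σ τ : ℂ) : ℝ≥0∞ :=
  ⨆ z ∈ Metric.ball (0 : ℂ) 1,
    ENNReal.ofReal ((‖τ - f z‖ ^ 2 / (1 - ‖f z‖ ^ 2)) / (‖σ - z‖ ^ 2 / (1 - ‖z‖ ^ 2)))

/-- The boundary dilation coefficient `β_f(σ)`, the infimum of `β_f(σ, τ)` over `|τ| = 1`. -/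
noncomputable def boundaryDilation (f : ℂ → ℂ) (σ : ℂ) : ℝ≥0∞ :=
  ⨅ τ ∈ Metric.sphere (0 : ℂ) 1, dilationCoeffAt f σ τ

/-- The Stolz region of vertex `σ` and amplitude `M`. -/
def stolzRegion (σ : ℂ) (M : ℝ) : Set ℂ :=
  {z | z ∈ Metric.ball (0 : ℂ) 1 ∧ ‖σ - z‖ / (1 - ‖z‖) < M}

/-- `f` has non-tangential limit `c` at the boundary point `σ`. -/
def HasNontangentialLimit (f : ℂ → ℂ) (σ c : ℂ) : Prop :=
  ∀ M : ℝ, 1 < M → Filter.Tendsto f (nhdsWithin σ (stolzRegion σ M)) (nhds c)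

/-! Conjugate `f` by the disk automorphism `φ` sending `z₀` to `0`. The zero of order at least `k`
at the origin can be divided out: `φ ∘ f ∘ φ⁻¹` is `w ^ k * h w`, where `h` maps the disk to itself
(maximum principle; a unimodular constant `h` would make `f` a Blaschke product of degree `k`) and
`h 0` is the normalized `k`-th Taylor coefficient on the right-hand side (`exists_conj_eq_pow_mul`).
With `ζ j = φ (σ j)`, the prescribed values of `f` say that `h` tends radially to `1` at `ζ j`.
Conjugation multiplies the dilation coefficient by `‖σ j - z₀‖² / ‖τ j - z₀‖²`, which is the factor
`1 + 2 Re ...`, and dividing by `w ^ k` subtracts `k` (`tendsto_of_dilation_pow_mul`). So each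
denominator on the left is the dilation coefficient of `h` at `ζ j`.

What remains is `sum_boundary_le`. The function `F = (1 + h) / (1 - h)` has non-negative real part,
and the reciprocals `c j` of these denominators are the masses of its Herglotz measure at the points
`ζ j`. Removing these atoms leaves a non-negative real part (`re_sub_sum_herglotz_nonneg`); its
value at `0` is the inequality.

Equality means that the remaining real part vanishes at `0`, so by a Harnack-type bound the
remainder is an imaginary constant. Then `F` is a finite sum of Herglotz kernels plus that constant,
and `h` is a Blaschke product of degree `n`. Conversely, for such `h` the `n` atoms exhaust `F` by a
degree count. Multiplying by `w ^ k` and undoing the conjugation turns degree `n` for `h` into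
degree `n + k` for `f`. -/

theorem re_add_div_sub (a b : ℂ) :
    ((a + b) / (a - b)).re = (‖a‖ ^ 2 - ‖b‖ ^ 2) / ‖a - b‖ ^ 2 := by
  rw [Complex.div_re]
  simp only [Complex.sq_norm, Complex.normSq_apply, Complex.add_re, Complex.add_im, Complex.sub_re,
    Complex.sub_im]
  ring

/-! ### Automorphisms of the disk. -/

section DiskAutomorphism

open Metric Filter Topology ComplexConjugate

/-- The automorphism of the unit disk that sends `a` to `0`. -/
noncomputable def diskAut (a z : ℂ) : ℂ := (z - a) / (1 - conj a * z)

variable {a z w : ℂ}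

theorem one_sub_conj_mul_ne_zero (ha : ‖a‖ < 1) (hz : ‖z‖ ≤ 1) : 1 - conj a * z ≠ 0 := by
  intro h
  have h1 : conj a * z = 1 := (sub_eq_zero.mp h).symm
  have h2 : ‖a‖ * ‖z‖ = 1 := by simpa using congrArg norm h1
  nlinarith [norm_nonneg a, norm_nonneg z]

theorem norm_sq_one_sub_conj_mul_sub (a z : ℂ) :
    ‖1 - conj a * z‖ ^ 2 - ‖z - a‖ ^ 2 = (1 - ‖z‖ ^ 2) * (1 - ‖a‖ ^ 2) := by
  simp only [Complex.sq_norm, Complex.normSq_apply, Complex.sub_re, Complex.sub_im,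
    Complex.one_re, Complex.one_im, Complex.mul_re, Complex.mul_im, Complex.conj_re,
    Complex.conj_im]
  ring

theorem one_sub_norm_diskAut_sq (ha : ‖a‖ < 1) (hz : ‖z‖ ≤ 1) :
    1 - ‖diskAut a z‖ ^ 2 = (1 - ‖z‖ ^ 2) * (1 - ‖a‖ ^ 2) / ‖1 - conj a * z‖ ^ 2 := by
  have h := norm_pos_iff.mpr (one_sub_conj_mul_ne_zero ha hz)
  rw [← norm_sq_one_sub_conj_mul_sub, diskAut, norm_div, div_pow, sub_div, div_self (by positivity)]

theorem norm_diskAut_lt_one (ha : ‖a‖ < 1) (hz : ‖z‖ < 1) : ‖diskAut a z‖ < 1 := by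
  have h := one_sub_norm_diskAut_sq ha hz.le
  have h0 := norm_pos_iff.mpr (one_sub_conj_mul_ne_zero ha hz.le)
  have h1 : 0 < (1 - ‖z‖ ^ 2) * (1 - ‖a‖ ^ 2) / ‖1 - conj a * z‖ ^ 2 := by
    have : 0 < 1 - ‖z‖ ^ 2 := by nlinarith [norm_nonneg z]
    have : 0 < 1 - ‖a‖ ^ 2 := by nlinarith [norm_nonneg a]
    positivity
  nlinarith [norm_nonneg (diskAut a z)]

theorem norm_diskAut_eq_one (ha : ‖a‖ < 1) (hz : ‖z‖ = 1) : ‖diskAut a z‖ = 1 := by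
  have h := one_sub_norm_diskAut_sq ha hz.le
  rw [hz] at h
  simp only [one_pow, sub_self, zero_mul, zero_div] at h
  exact (pow_eq_one_iff_of_nonneg (norm_nonneg _) two_ne_zero).mp (by linarith)

theorem diskAut_neg_diskAut (ha : ‖a‖ < 1) (hz : ‖z‖ ≤ 1) : diskAut (-a) (diskAut a z) = z := by
  have h := one_sub_conj_mul_ne_zero ha hz
  have h' : (1 - conj a * a) ≠ 0 := one_sub_conj_mul_ne_zero ha ha.le
  rw [mul_comm] at h
  have h2 : 1 - conj (-a) * ((z - a) / (1 - conj a * z)) = (1 - conj a * a) / (1 - conj a * z) := by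
    rw [map_neg, mul_comm _ z]; have := mul_comm z (conj a) ▸ h; field_simp; ring
  have h3 : (z - a) / (1 - conj a * z) - -a = z * (1 - conj a * a) / (1 - conj a * z) := by
    rw [mul_comm _ z]; field_simp; ring
  rw [diskAut, diskAut, h2, h3, mul_comm _ z]
  field_simp

theorem diskAut_diskAut_neg (ha : ‖a‖ < 1) (hz : ‖z‖ ≤ 1) : diskAut a (diskAut (-a) z) = z := by
  simpa using diskAut_neg_diskAut (a := -a) (by simpa using ha) hz

theorem diskAut_sub_diskAut (ha : ‖a‖ < 1) (hz : ‖z‖ ≤ 1) (hw : ‖w‖ ≤ 1) :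
    diskAut a z - diskAut a w =
      (z - w) * (1 - conj a * a) / ((1 - conj a * z) * (1 - conj a * w)) := by
  have h := one_sub_conj_mul_ne_zero ha hz
  have h' := one_sub_conj_mul_ne_zero ha hw
  rw [diskAut, diskAut, div_sub_div _ _ h h']
  congr 1
  ring

theorem differentiableAt_diskAut (ha : ‖a‖ < 1) (hz : ‖z‖ ≤ 1) :
    DifferentiableAt ℂ (diskAut a) z := by
  unfold diskAut
  exact DifferentiableAt.div (by fun_prop) (by fun_prop) (one_sub_conj_mul_ne_zero ha hz)

theorem differentiableOn_diskAut (ha : ‖a‖ < 1) : DifferentiableOn ℂ (diskAut a) (ball 0 1) :=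
  fun z hz => (differentiableAt_diskAut ha
    (by simpa using (mem_ball_zero_iff.mp hz).le)).differentiableWithinAt

theorem mapsTo_diskAut (ha : ‖a‖ < 1) : Set.MapsTo (diskAut a) (ball 0 1) (ball 0 1) :=
  fun z hz => by
    rw [mem_ball_zero_iff] at *
    exact norm_diskAut_lt_one ha hz

@[simp] theorem diskAut_zero (a : ℂ) : diskAut a 0 = -a := by simp [diskAut]

end DiskAutomorphism

/-! ### Functions with non-negative real part: Harnack bound, Julia–Carathéodory, removal of atoms.
-/

section PositiveRealPart

open Metric Filter Topology ComplexConjugate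

variable {G F : ℂ → ℂ} {z z₁ ζ : ℂ} {c : ℝ}

/-- Schwarz's lemma for the Cayley transform `B` of `G`, after moving `z₁` to the origin. The bound
is proportional to `(G z₁).re`, which serves two purposes: it forces rigidity when that real part
vanishes, and it controls the growth of `G` along a radius when that real part is small. -/
theorem norm_sub_le_of_re_pos (hG : DifferentiableOn ℂ G (ball 0 1))
    (hre : ∀ z ∈ ball (0 : ℂ) 1, 0 < (G z).re) (hz₁ : ‖z₁‖ < 1) (hz : ‖z‖ < 1) :
    ‖G z - (G z₁).im * Complex.I‖ ≤
      (G z₁).re * (4 * ‖1 - conj z₁ * z‖ ^ 2 / ((1 - ‖z‖ ^ 2) * (1 - ‖z₁‖ ^ 2))) := by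
  have hz₁' : ‖-z₁‖ < 1 := by simpa using hz₁
  have hx : 0 < (G z₁).re := hre z₁ (by simpa using hz₁)
  have hden : ∀ u ∈ ball (0 : ℂ) 1, G (diskAut (-z₁) u) + conj (G z₁) ≠ 0 := by
    intro u hu h
    have := hre _ (mapsTo_diskAut hz₁' hu)
    have h' := congrArg Complex.re h
    simp at h'
    linarith
  have hcomp : DifferentiableOn ℂ (fun u => G (diskAut (-z₁) u)) (ball 0 1) :=
    hG.comp (differentiableOn_diskAut hz₁') (mapsTo_diskAut hz₁')
  set B : ℂ → ℂ := fun u => (G (diskAut (-z₁) u) - G z₁) / (G (diskAut (-z₁) u) + conj (G z₁))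
    with hB
  have hBd : DifferentiableOn ℂ B (ball 0 1) :=
    (hcomp.sub_const _).div (hcomp.add_const _) hden
  have hB1 : ∀ u ∈ ball (0 : ℂ) 1, ‖B u‖ ≤ 1 := by
    intro u hu
    rw [hB, norm_div, div_le_one (norm_pos_iff.mpr (hden u hu)), ← sq_le_sq₀ (norm_nonneg _)
      (norm_nonneg _)]
    have := hre _ (mapsTo_diskAut hz₁' hu)
    simp only [Complex.sq_norm, Complex.normSq_apply, Complex.sub_re, Complex.sub_im,
      Complex.add_re, Complex.add_im, Complex.conj_re, Complex.conj_im]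
    nlinarith
  set w := diskAut z₁ z with hw
  have hw1 : ‖w‖ < 1 := norm_diskAut_lt_one hz₁ hz
  have hwz : diskAut (-z₁) w = z := diskAut_neg_diskAut hz₁ hz.le
  have hBw : ‖B w‖ ≤ ‖w‖ := by
    refine Complex.norm_le_norm_of_mapsTo_ball hBd (fun u hu => ?_) (by simp [hB]) hw1
    simpa using hB1 u hu
  have hBw' : B w = (G z - G z₁) / (G z + conj (G z₁)) := by simp [hB, hwz]
  have hd : G z + conj (G z₁) ≠ 0 := by
    have := hden w (by simpa using hw1); rwa [hwz] at this
  have h2x : (G z₁ + conj (G z₁)) ≠ 0 := by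
    rw [Complex.add_conj]; exact_mod_cast (by positivity : (2 * (G z₁).re) ≠ 0)
  have h1B : 1 - B w = (G z₁ + conj (G z₁)) / (G z + conj (G z₁)) := by
    rw [hBw']; field_simp; ring
  have h1B0 : 1 - B w ≠ 0 := by rw [h1B]; exact div_ne_zero h2x hd
  have hid : G z - (G z₁).im * Complex.I = (G z₁).re * ((1 + B w) / (1 - B w)) := by
    have e1 : ((G z₁).re : ℂ) = (G z₁ + conj (G z₁)) / 2 := by rw [Complex.add_conj]; simp
    have e2 : ((G z₁).im : ℂ) * Complex.I = (G z₁ - conj (G z₁)) / 2 := by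
      rw [Complex.sub_conj]; push_cast; ring
    rw [h1B, hBw', e1, e2]
    field_simp
    ring
  rw [hid, norm_mul, Complex.norm_real, Real.norm_of_nonneg hx.le]
  refine mul_le_mul_of_nonneg_left ?_ hx.le
  have h1 := one_sub_norm_diskAut_sq hz₁ hz.le
  rw [← hw] at h1
  have hP : 0 < ‖1 - conj z₁ * z‖ := norm_pos_iff.mpr (one_sub_conj_mul_ne_zero hz₁ hz.le)
  have ha : 0 < 1 - ‖z‖ ^ 2 := by nlinarith [norm_nonneg z]
  have hb : 0 < 1 - ‖z₁‖ ^ 2 := by nlinarith [norm_nonneg z₁]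
  have h4 : 4 * ‖1 - conj z₁ * z‖ ^ 2 / ((1 - ‖z‖ ^ 2) * (1 - ‖z₁‖ ^ 2)) = 4 / (1 - ‖w‖ ^ 2) := by
    rw [h1]; field_simp
  have hBlt : ‖B w‖ < 1 := hBw.trans_lt hw1
  have hw0 := norm_nonneg w
  have hw2 : 0 < 1 - ‖w‖ ^ 2 := by nlinarith
  have hnum : ‖1 + B w‖ ≤ 1 + ‖w‖ := (norm_add_le _ _).trans (by simpa using hBw)
  have hden' : 1 - ‖w‖ ≤ ‖1 - B w‖ := by
    have := norm_sub_norm_le 1 (B w)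
    simp only [norm_one] at this
    linarith
  rw [h4, norm_div]
  calc ‖1 + B w‖ / ‖1 - B w‖ ≤ (1 + ‖w‖) / (1 - ‖w‖) := by
        apply div_le_div₀ <;> linarith
    _ ≤ 4 / (1 - ‖w‖ ^ 2) := by
        rw [div_le_div_iff₀ (by linarith) hw2]
        nlinarith [mul_nonneg (sub_nonneg.mpr hw1.le) (sub_nonneg.mpr hw1.le)]

/-- Apply the strict version to `G + ε` and let `ε → 0`. This admits `(G z₁).re = 0`, the case
needed for equality. -/
theorem norm_sub_le_of_re_nonneg (hG : DifferentiableOn ℂ G (ball 0 1))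
    (hre : ∀ z ∈ ball (0 : ℂ) 1, 0 ≤ (G z).re) (hz₁ : ‖z₁‖ < 1) (hz : ‖z‖ < 1) :
    ‖G z - (G z₁).im * Complex.I‖ ≤
      (G z₁).re * (4 * ‖1 - conj z₁ * z‖ ^ 2 / ((1 - ‖z‖ ^ 2) * (1 - ‖z₁‖ ^ 2))) := by
  have key : ∀ ε : ℝ, 0 < ε → ‖G z + ε - (G z₁).im * Complex.I‖ ≤
      ((G z₁).re + ε) * (4 * ‖1 - conj z₁ * z‖ ^ 2 / ((1 - ‖z‖ ^ 2) * (1 - ‖z₁‖ ^ 2))) := by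
    intro ε hε
    have := norm_sub_le_of_re_pos (G := fun z => G z + ε) (hG.add_const _)
      (fun z hz => by simpa using add_pos_of_nonneg_of_pos (hre z hz) hε) hz₁ hz
    simpa using this
  have hl : Tendsto (fun ε : ℝ => ‖G z + ε - (G z₁).im * Complex.I‖) (𝓝[>] 0)
      (𝓝 ‖G z - (G z₁).im * Complex.I‖) := by
    have : Continuous (fun ε : ℝ => ‖G z + ε - (G z₁).im * Complex.I‖) := by fun_prop
    simpa using (this.tendsto 0).mono_left nhdsWithin_le_nhds
  have hr : Tendsto (fun ε : ℝ => ((G z₁).re + ε) *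
      (4 * ‖1 - conj z₁ * z‖ ^ 2 / ((1 - ‖z‖ ^ 2) * (1 - ‖z₁‖ ^ 2)))) (𝓝[>] 0)
      (𝓝 ((G z₁).re * (4 * ‖1 - conj z₁ * z‖ ^ 2 / ((1 - ‖z‖ ^ 2) * (1 - ‖z₁‖ ^ 2))))) := by
    have : Continuous (fun ε : ℝ => ((G z₁).re + ε) *
      (4 * ‖1 - conj z₁ * z‖ ^ 2 / ((1 - ‖z‖ ^ 2) * (1 - ‖z₁‖ ^ 2)))) := by fun_prop
    simpa using (this.tendsto 0).mono_left nhdsWithin_le_nhds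
  exact le_of_tendsto_of_tendsto hl hr (eventually_nhdsWithin_of_forall fun ε hε => key ε hε)

/-- The Poisson kernel of the unit disk. -/
noncomputable def diskPoisson (ζ z : ℂ) : ℝ := (1 - ‖z‖ ^ 2) / ‖ζ - z‖ ^ 2

/-- The Herglotz kernel of the unit disk, whose real part is the Poisson kernel. -/
noncomputable def herglotz (ζ z : ℂ) : ℂ := (ζ + z) / (ζ - z)

theorem herglotz_re (hζ : ‖ζ‖ = 1) : (herglotz ζ z).re = diskPoisson ζ z := by
  rw [herglotz, re_add_div_sub, hζ, diskPoisson, one_pow]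

theorem sub_ne_zero_of_norm (hζ : ‖ζ‖ = 1) (hz : ‖z‖ < 1) : ζ - z ≠ 0 := by
  intro h
  rw [sub_eq_zero.mp h] at hζ
  linarith

theorem diskPoisson_pos (hζ : ‖ζ‖ = 1) (hz : ‖z‖ < 1) : 0 < diskPoisson ζ z := by
  have := norm_pos_iff.mpr (sub_ne_zero_of_norm hζ hz)
  have : 0 < 1 - ‖z‖ ^ 2 := by nlinarith [norm_nonneg z]
  unfold diskPoisson
  positivity

theorem differentiableOn_herglotz (hζ : ‖ζ‖ = 1) :
    DifferentiableOn ℂ (herglotz ζ) (ball 0 1) := by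
  unfold herglotz
  refine DifferentiableOn.div (by fun_prop) (by fun_prop) fun z hz => ?_
  exact sub_ne_zero_of_norm hζ (by simpa using hz)

theorem norm_ofReal_mul_lt_one (hζ : ‖ζ‖ = 1) {r : ℝ} (hr : r ∈ Set.Ioo (0 : ℝ) 1) :
    ‖(r : ℂ) * ζ‖ < 1 := by
  rw [norm_mul, hζ, mul_one, Complex.norm_real, Real.norm_of_nonneg hr.1.le]
  exact hr.2

theorem eventually_Ioo_zero_one : ∀ᶠ r : ℝ in 𝓝[<] 1, r ∈ Set.Ioo (0 : ℝ) 1 :=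
  Ioo_mem_nhdsLT one_pos

theorem tendsto_one_sub_mul_of_forall_lt (hG : DifferentiableOn ℂ G (ball 0 1))
    (hre : ∀ z ∈ ball (0 : ℂ) 1, 0 ≤ (G z).re) (hζ : ‖ζ‖ = 1)
    (hinf : ∀ ε > 0, ∃ z ∈ ball (0 : ℂ) 1, (G z).re < ε * diskPoisson ζ z) :
    Tendsto (fun r : ℝ => (1 - r : ℂ) * G (r * ζ)) (𝓝[<] 1) (𝓝 0) := by
  rw [tendsto_zero_iff_norm_tendsto_zero]
  refine tendsto_order.mpr ⟨fun b hb => Eventually.of_forall fun r => hb.trans_le (norm_nonneg _),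
    fun b hb => ?_⟩
  obtain ⟨z₁, hz₁, hlt⟩ := hinf (b / 2) (half_pos hb)
  rw [mem_ball_zero_iff] at hz₁
  have hb1 : 0 < 1 - ‖z₁‖ ^ 2 := by nlinarith [norm_nonneg z₁]
  -- `U` is the Harnack bound along the radius multiplied by `1 - r`, with the singular factor of `1
  -- - r ^ 2 = (1 - r) * (1 + r)` cancelled, hence continuous at `1`. There it equals twice `(G
  -- z₁).re / diskPoisson ζ z₁`, which is why `z₁` was chosen with `b / 2`.
  set U : ℝ → ℝ := fun r => (1 - r) * |(G z₁).im| +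
    (G z₁).re * (4 * ‖1 - conj z₁ * (r * ζ)‖ ^ 2 / ((1 + r) * (1 - ‖z₁‖ ^ 2))) with hU
  have hU1 : U 1 < b := by
    have e : ‖1 - conj z₁ * ζ‖ ^ 2 = ‖ζ - z₁‖ ^ 2 := by
      have := norm_sq_one_sub_conj_mul_sub z₁ ζ
      rw [hζ] at this; linarith
    have hp : 0 < ‖ζ - z₁‖ ^ 2 := pow_pos (norm_pos_iff.mpr (sub_ne_zero_of_norm hζ hz₁)) 2
    have hp2 := diskPoisson_pos hζ hz₁
    have : U 1 = 2 * ((G z₁).re / diskPoisson ζ z₁) := by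
      simp only [hU, sub_self, zero_mul, zero_add, Complex.ofReal_one, one_mul, e, diskPoisson]
      field_simp
      ring
    rw [this]
    have := (div_lt_iff₀ hp2).mpr hlt
    linarith
  have hUc : Tendsto U (𝓝[<] 1) (𝓝 (U 1)) := by
    refine (ContinuousAt.tendsto ?_).mono_left nhdsWithin_le_nhds
    have : (1 + 1 : ℝ) * (1 - ‖z₁‖ ^ 2) ≠ 0 := by positivity
    fun_prop (disch := assumption)
  filter_upwards [(tendsto_order.mp hUc).2 b hU1, eventually_Ioo_zero_one] with r hr hr'
  refine lt_of_le_of_lt ?_ hr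
  have hn := norm_ofReal_mul_lt_one hζ hr'
  have h := norm_sub_le_of_re_nonneg hG hre hz₁ hn
  have hnr : ‖(r : ℂ) * ζ‖ = r := by
    rw [norm_mul, hζ, mul_one, Complex.norm_real, Real.norm_of_nonneg hr'.1.le]
  have hr1 : 0 < 1 - r := by linarith [hr'.2]
  have hr0 := hr'.1
  have h2 : ‖G (r * ζ)‖ ≤ |(G z₁).im| + ‖G (r * ζ) - (G z₁).im * Complex.I‖ := by
    have := norm_add_le ((G z₁).im * Complex.I) (G (r * ζ) - (G z₁).im * Complex.I)
    simpa using this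
  have h1r : ‖(1 - r : ℂ)‖ = 1 - r := by
    rw [← Complex.ofReal_one, ← Complex.ofReal_sub, Complex.norm_real, Real.norm_of_nonneg hr1.le]
  rw [norm_mul, h1r]
  calc (1 - r) * ‖G (r * ζ)‖ ≤ (1 - r) * (|(G z₁).im| + (G z₁).re *
        (4 * ‖1 - conj z₁ * (r * ζ)‖ ^ 2 / ((1 - ‖(r : ℂ) * ζ‖ ^ 2) * (1 - ‖z₁‖ ^ 2)))) := by
        gcongr; linarith
    _ = U r := by
        rw [hnr, hU]
        have : (1 - r ^ 2) = (1 - r) * (1 + r) := by ring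
        rw [this]
        field_simp

theorem one_sub_mul_herglotz_self (hζ : ‖ζ‖ = 1) {r : ℝ} (hr : r ∈ Set.Ioo (0 : ℝ) 1) :
    (1 - r : ℂ) * herglotz ζ (r * ζ) = 1 + r := by
  have h0 : ζ ≠ 0 := by rintro rfl; simp at hζ
  have h1 : (1 - r : ℂ) ≠ 0 := by
    exact_mod_cast (by linarith [hr.2] : (1 - r : ℝ) ≠ 0)
  rw [herglotz, show ζ - r * ζ = (1 - r) * ζ by ring, show ζ + r * ζ = (1 + r) * ζ by ring]
  field_simp

/-- **Julia–Carathéodory theorem** for functions with non-negative real part. -/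
theorem tendsto_one_sub_mul_of_isGLB (hF : DifferentiableOn ℂ F (ball 0 1)) (hζ : ‖ζ‖ = 1)
    (hle : ∀ z ∈ ball (0 : ℂ) 1, c * diskPoisson ζ z ≤ (F z).re)
    (hinf : ∀ c' > c, ∃ z ∈ ball (0 : ℂ) 1, (F z).re < c' * diskPoisson ζ z) :
    Tendsto (fun r : ℝ => (1 - r : ℂ) * F (r * ζ)) (𝓝[<] 1) (𝓝 (2 * c)) := by
  -- Subtracting the extremal multiple of the kernel reduces to the case of constant zero; the
  -- kernel itself contributes `c * (1 + r)`.
  have h := tendsto_one_sub_mul_of_forall_lt (G := fun z => F z - c * herglotz ζ z)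
    (hF.sub ((differentiableOn_herglotz hζ).const_mul _))
    (fun z hz => by
      have := hle z hz
      simp only [Complex.sub_re, Complex.re_ofReal_mul, herglotz_re hζ]; linarith) hζ
    (fun ε hε => by
      obtain ⟨z, hz, h⟩ := hinf (c + ε) (by linarith)
      refine ⟨z, hz, ?_⟩
      simp only [Complex.sub_re, Complex.re_ofReal_mul, herglotz_re hζ]; linarith)
  have h2 : Tendsto (fun r : ℝ => (c : ℂ) * (1 + r)) (𝓝[<] 1) (𝓝 (c * (1 + (1 : ℝ)))) :=
    (Continuous.tendsto (by fun_prop) 1).mono_left nhdsWithin_le_nhds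
  have h3 := h.add h2
  have e : (0 : ℂ) + c * (1 + (1 : ℝ)) = 2 * c := by push_cast; ring
  rw [e] at h3
  refine h3.congr' ?_
  filter_upwards [eventually_Ioo_zero_one] with r hr
  rw [← one_sub_mul_herglotz_self hζ hr]
  ring

/-- The constant is the infimum of `(F z).re / diskPoisson ζ z`, that is, the mass at `ζ` of the
Herglotz measure of `F`. -/
theorem exists_tendsto_one_sub_mul (hF : DifferentiableOn ℂ F (ball 0 1))
    (hre : ∀ z ∈ ball (0 : ℂ) 1, 0 ≤ (F z).re) (hζ : ‖ζ‖ = 1) :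
    ∃ c : ℝ, 0 ≤ c ∧ (∀ z ∈ ball (0 : ℂ) 1, c * diskPoisson ζ z ≤ (F z).re) ∧
      Tendsto (fun r : ℝ => (1 - r : ℂ) * F (r * ζ)) (𝓝[<] 1) (𝓝 (2 * c)) := by
  set S : Set ℝ := (fun z => (F z).re / diskPoisson ζ z) '' ball 0 1
  have hS0 : ∀ x ∈ S, 0 ≤ x := by
    rintro x ⟨z, hz, rfl⟩
    exact div_nonneg (hre z hz) (diskPoisson_pos hζ (by simpa using hz)).le
  have hSb : BddBelow S := ⟨0, hS0⟩
  have hSn : S.Nonempty := ⟨_, ⟨0, by simp, rfl⟩⟩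
  have hle : ∀ z ∈ ball (0 : ℂ) 1, sInf S * diskPoisson ζ z ≤ (F z).re := fun z hz =>
    (le_div_iff₀ (diskPoisson_pos hζ (by simpa using hz))).mp (csInf_le hSb ⟨z, hz, rfl⟩)
  refine ⟨sInf S, le_csInf hSn hS0, hle, tendsto_one_sub_mul_of_isGLB hF hζ hle fun c' hc' => ?_⟩
  obtain ⟨_, ⟨z, hz, rfl⟩, h⟩ := exists_lt_of_csInf_lt hSn hc'
  exact ⟨z, hz, (div_lt_iff₀ (diskPoisson_pos hζ (by simpa using hz))).mp h⟩

theorem tendsto_one_sub_mul_herglotz_of_ne {η : ℂ} (h : ζ ≠ η) :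
    Tendsto (fun r : ℝ => (1 - r : ℂ) * herglotz η (r * ζ)) (𝓝[<] 1) (𝓝 0) := by
  have h0 : η - ((1 : ℝ) : ℂ) * ζ ≠ 0 := by
    rw [Complex.ofReal_one, one_mul]; exact sub_ne_zero.mpr h.symm
  have : ContinuousAt (fun r : ℝ => (1 - r : ℂ) * ((η + r * ζ) / (η - r * ζ))) 1 := by
    fun_prop (disch := assumption)
  simpa [herglotz] using this.tendsto.mono_left nhdsWithin_le_nhds

variable {ι : Type*} {p : ι → ℂ} {m : ι → ℝ}

/-- The atoms are removed one at a time. Kernels with other poles stay bounded along the radius to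
`p a`, so earlier subtractions leave the radial limit there unchanged, and the mass still available
at `p a` is exactly `m a`. -/
theorem re_sub_sum_herglotz_nonneg (hF : DifferentiableOn ℂ F (ball 0 1))
    (hre : ∀ z ∈ ball (0 : ℂ) 1, 0 ≤ (F z).re) (hp : ∀ j, ‖p j‖ = 1) (hinj : Function.Injective p)
    (hlim : ∀ j, Tendsto (fun r : ℝ => (1 - r : ℂ) * F (r * p j)) (𝓝[<] 1) (𝓝 (2 * m j)))
    (s : Finset ι) : ∀ z ∈ ball (0 : ℂ) 1, 0 ≤ (F z - ∑ j ∈ s, m j * herglotz (p j) z).re := by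
  classical
  induction s using Finset.induction_on with
  | empty => simpa using hre
  | insert a s has ih =>
    have hd : DifferentiableOn ℂ (fun z => F z - ∑ j ∈ s, m j * herglotz (p j) z) (ball 0 1) :=
      hF.sub (DifferentiableOn.fun_sum fun j _ => (differentiableOn_herglotz (hp j)).const_mul _)
    obtain ⟨c, -, hc, hcl⟩ := exists_tendsto_one_sub_mul hd ih (hp a)
    have hl : Tendsto (fun r : ℝ => (1 - r : ℂ) * F (r * p a) -
        ∑ j ∈ s, m j * ((1 - r : ℂ) * herglotz (p j) (r * p a))) (𝓝[<] 1)
        (𝓝 (2 * m a - ∑ j ∈ s, (m j : ℂ) * 0)) := by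
      refine (hlim a).sub (tendsto_finsetSum _ fun j hj => Tendsto.const_mul _ ?_)
      refine tendsto_one_sub_mul_herglotz_of_ne fun h => has ?_
      rwa [hinj h]
    have hEq : (2 * c : ℂ) = 2 * m a := by
      have := tendsto_nhds_unique hcl (hl.congr fun r => by
        rw [mul_sub, Finset.mul_sum]
        congr 1
        exact Finset.sum_congr rfl fun j _ => by ring)
      simpa using this
    have hca : c = m a := by exact_mod_cast mul_left_cancel₀ two_ne_zero hEq
    intro z hz
    have h1 := hc z hz
    rw [Finset.sum_insert has, hca] at *
    simp only [Complex.sub_re, Complex.add_re, Complex.re_ofReal_mul, herglotz_re (hp a)] at *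
    linarith

end PositiveRealPart

/-! ### Blaschke products as quotients of reciprocal polynomials. -/

section Blaschke

open Metric Filter Topology ComplexConjugate Polynomial

variable {d : ℕ} {B B' h : ℂ → ℂ} {w : ℂ}

theorem isBlaschkeProduct_iff : IsBlaschkeProduct d B ↔ ∃ (u : ℂ) (a : Fin d → ℂ), ‖u‖ = 1 ∧
    (∀ j, ‖a j‖ < 1) ∧ ∀ z, ‖z‖ < 1 → B z = u * ∏ j, (z - a j) / (1 - conj (a j) * z) := by
  constructor
  · rintro ⟨θ, a, ha, hB⟩
    exact ⟨_, a, Complex.norm_exp_ofReal_mul_I θ, fun j => by simpa using ha j,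
      fun z hz => hB z (by simpa using hz)⟩
  · rintro ⟨u, a, hu, ha, hB⟩
    obtain ⟨θ, rfl⟩ := (Complex.norm_eq_one_iff u).mp hu
    exact ⟨θ, a, fun j => by simpa using ha j, fun z hz => hB z (by simpa using hz)⟩

theorem IsBlaschkeProduct.congr (hB : IsBlaschkeProduct d B)
    (h : ∀ z, ‖z‖ < 1 → B' z = B z) : IsBlaschkeProduct d B' := by
  obtain ⟨u, a, hu, ha, hB⟩ := isBlaschkeProduct_iff.mp hB
  exact isBlaschkeProduct_iff.mpr ⟨u, a, hu, ha, fun z hz => (h z hz).trans (hB z hz)⟩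

/-- On the circle `conj z = 1 / z`, so the denominator is, up to a unimodular constant, the
reciprocal polynomial of the numerator. Unlike the product formula, this relation visibly survives
Möbius maps applied to `B`. -/
theorem IsBlaschkeProduct.exists_polynomial (hB : IsBlaschkeProduct d B) :
    ∃ (P Q : ℂ[X]) (u : ℂ), ‖u‖ = 1 ∧ P.natDegree ≤ d ∧ Q.natDegree ≤ d ∧
      (∀ z, ‖z‖ ≤ 1 → Q.eval z ≠ 0) ∧ (∀ z, ‖z‖ ≤ 1 → ‖P.eval z‖ ≤ ‖Q.eval z‖) ∧
      (∀ z, ‖z‖ = 1 → Q.eval z = u * z ^ d * conj (P.eval z)) ∧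
      ∀ z, ‖z‖ < 1 → B z = P.eval z / Q.eval z := by
  obtain ⟨u, a, hu, ha, hB⟩ := isBlaschkeProduct_iff.mp hB
  refine ⟨C u * ∏ j, (X - C (a j)), ∏ j, (1 - C (conj (a j)) * X), u, hu, ?_, ?_, ?_, ?_, ?_, ?_⟩
  · refine (natDegree_C_mul_le _ _).trans ((natDegree_prod_le _ _).trans ?_)
    refine (Finset.sum_le_card_nsmul _ _ 1 fun j _ => ?_).trans (by simp)
    exact natDegree_X_sub_C_le _
  · refine (natDegree_prod_le _ _).trans ?_
    refine (Finset.sum_le_card_nsmul _ _ 1 fun j _ => ?_).trans (by simp)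
    refine (natDegree_sub_le _ _).trans ?_
    simpa using (natDegree_C_mul_le _ _).trans natDegree_X_le
  · intro z hz
    simp only [eval_prod, eval_sub, eval_one, eval_mul, eval_C, eval_X]
    exact Finset.prod_ne_zero_iff.mpr fun j _ => one_sub_conj_mul_ne_zero (ha j) hz
  · intro z hz
    simp only [eval_prod, eval_sub, eval_one, eval_mul, eval_C, eval_X, norm_mul, hu, one_mul,
      norm_prod]
    refine Finset.prod_le_prod (fun _ _ => norm_nonneg _) fun j _ => ?_
    have h := norm_sq_one_sub_conj_mul_sub (a j) z
    have h1 : 0 ≤ (1 - ‖z‖ ^ 2) * (1 - ‖a j‖ ^ 2) :=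
      mul_nonneg (by nlinarith [norm_nonneg z]) (by nlinarith [norm_nonneg (a j), ha j])
    exact (sq_le_sq₀ (norm_nonneg _) (norm_nonneg _)).mp (by linarith)
  · intro z hz
    have hzz : z * conj z = 1 := by rw [Complex.mul_conj, Complex.normSq_eq_norm_sq, hz]; simp
    have huu : u * conj u = 1 := by rw [Complex.mul_conj, Complex.normSq_eq_norm_sq, hu]; simp
    simp only [eval_prod, eval_sub, eval_one, eval_mul, eval_C, eval_X, map_mul, map_prod, map_sub]
    have : z ^ d = ∏ _j : Fin d, z := by simp
    rw [this, show ∀ x y z : ℂ, u * x * (y * z) = (u * y) * (x * z) by intros; ring, huu, one_mul,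
      ← Finset.prod_mul_distrib]
    refine Finset.prod_congr rfl fun j _ => ?_
    rw [mul_sub, hzz, mul_comm]
  · intro z hz
    simp only [eval_prod, eval_sub, eval_one, eval_mul, eval_C, eval_X, hB z hz,
      Finset.prod_div_distrib]
    ring

theorem pow_card_mul_conj_prod_sub (s : Multiset ℂ) {z : ℂ} (hz : ‖z‖ = 1) :
    z ^ s.card * conj (s.map fun b => z - b).prod = (s.map fun b => 1 - conj b * z).prod := by
  have hzz : z * conj z = 1 := by rw [Complex.mul_conj, Complex.normSq_eq_norm_sq, hz]; simp
  induction s using Multiset.induction_on with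
  | empty => simp
  | cons b s ih =>
    rw [Multiset.card_cons, Multiset.map_cons, Multiset.map_cons, Multiset.prod_cons,
      Multiset.prod_cons, ← ih, map_mul, map_sub]
    linear_combination (z ^ s.card * conj (s.map fun b => z - b).prod) * hzz

theorem infinite_unit_sphere : (sphere (0 : ℂ) 1).Infinite := by
  have : (sphere (0 : ℂ) 1).Nontrivial := ⟨1, by simp, -1, by simp, by norm_num⟩
  refine IsPreconnected.infinite_of_nontrivial ?_ this
  exact isPreconnected_sphere (by simp) _ _

/-- The relation on the circle, an infinite set, determines `Q` from the roots of `P`. That `Q` has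
no zero in the closed disk then fixes both the degree of `P` and the location of its roots. -/
theorem isBlaschkeProduct_of_polynomial {P Q : ℂ[X]} {u : ℂ} (hu : ‖u‖ = 1)
    (hd : P.natDegree ≤ d) (hQ : ∀ z, ‖z‖ ≤ 1 → Q.eval z ≠ 0)
    (hrel : ∀ z, ‖z‖ = 1 → Q.eval z = u * z ^ d * conj (P.eval z))
    (hB : ∀ z, ‖z‖ < 1 → B z = P.eval z / Q.eval z) : IsBlaschkeProduct d B := by
  set s := P.roots with hs
  set c := P.leadingCoeff with hc
  have hsplit : P.Splits := IsAlgClosed.splits P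
  have hP : P = C c * (s.map fun b => X - C b).prod := hsplit.eq_prod_roots
  have hcard : s.card = P.natDegree := hsplit.natDegree_eq_card_roots.symm
  have hPe : ∀ z, P.eval z = c * (s.map fun b => z - b).prod := by
    intro z
    conv_lhs => rw [hP]
    simp [eval_multiset_prod, Multiset.map_map]
  have hQ' : Q = C (u * conj c) * X ^ (d - s.card) * (s.map fun b => 1 - C (conj b) * X).prod := by
    refine eq_of_infinite_eval_eq _ _ (infinite_unit_sphere.mono fun z hz => ?_)
    rw [mem_sphere_zero_iff_norm] at hz
    have : z ^ d = z ^ (d - s.card) * z ^ s.card := by rw [← pow_add]; congr 1; omega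
    rw [Set.mem_ofPred_eq, hrel z hz, hPe, map_mul, this]
    simp only [eval_mul, eval_C, eval_pow, eval_X, eval_multiset_prod, Multiset.map_map,
      Function.comp_def, eval_sub, eval_one]
    rw [← pow_card_mul_conj_prod_sub s hz]
    ring
  have hQe : ∀ z, Q.eval z =
      u * conj c * z ^ (d - s.card) * (s.map fun b => 1 - conj b * z).prod := by
    intro z
    conv_lhs => rw [hQ']
    simp [eval_multiset_prod, Multiset.map_map]
  have hQ0 := hQ 0 (by simp)
  rw [hQe] at hQ0
  -- A drop in the degree of `P` would leave a factor `z ^ (d - s.card)` in `Q`, contradicting `Q 0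
  -- ≠ 0`.
  have hdeg : d = s.card := by
    by_contra hne
    exact hQ0 (by rw [zero_pow (by omega)]; simp)
  have hc0 : c ≠ 0 := by rintro h; exact hQ0 (by simp [h])
  -- A root `b` with `1 ≤ ‖b‖` would reflect to a zero `(conj b)⁻¹` of `Q` in the closed disk.
  have hb : ∀ b ∈ s, ‖b‖ < 1 := by
    intro b hbs
    by_contra hb1
    rw [not_lt] at hb1
    have hb0 : b ≠ 0 := by rintro rfl; simp at hb1; linarith
    refine hQ (conj b)⁻¹ ?_ ?_
    · rw [norm_inv, Complex.norm_conj]; exact inv_le_one_of_one_le₀ hb1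
    · rw [hQe, Multiset.prod_eq_zero, mul_zero]
      refine Multiset.mem_map.mpr ⟨b, hbs, ?_⟩
      rw [mul_inv_cancel₀ (by simpa using hb0), sub_self]
  have key : ∀ z, ‖z‖ < 1 →
      B z = c / (u * conj c) * (s.map fun b => (z - b) / (1 - conj b * z)).prod := by
    intro z hz
    rw [hB z hz, hPe, hQe, ← hdeg, Multiset.prod_map_div]
    simp only [tsub_self, pow_zero, mul_one]
    rw [mul_div_mul_comm]
  clear_value s
  subst hdeg
  obtain ⟨l, rfl⟩ := Quot.exists_rep s
  refine isBlaschkeProduct_iff.mpr ⟨c / (u * conj c), l.get, ?_, fun j => hb _ ?_, fun z hz => ?_⟩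
  · rw [norm_div, norm_mul, hu, Complex.norm_conj, one_mul, div_self (norm_ne_zero_iff.mpr hc0)]
  · exact List.get_mem l j
  · rw [key z hz]
    congr 1
    change (Multiset.map _ (l : Multiset ℂ)).prod = _
    rw [Multiset.map_coe, Multiset.prod_coe, ← List.prod_ofFn]
    congr 1
    conv_lhs => rw [← List.ofFn_get l]
    rw [List.map_ofFn]
    rfl

theorem IsBlaschkeProduct.diskAut_comp (hB : IsBlaschkeProduct d B) (hw : ‖w‖ < 1) :
    IsBlaschkeProduct d fun z => diskAut w (B z) := by
  obtain ⟨P, Q, u, hu, hP, hQ, hQ0, hPQ, hrel, hB⟩ := hB.exists_polynomial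
  have huu : u * conj u = 1 := by rw [Complex.mul_conj, Complex.normSq_eq_norm_sq, hu]; simp
  refine isBlaschkeProduct_of_polynomial (P := P - C w * Q) (Q := Q - C (conj w) * P) (u := u) hu
    ?_ ?_ ?_ ?_
  · simpa using natDegree_sub_le_of_le hP ((natDegree_C_mul_le w _).trans hQ)
  · intro z hz h0
    simp only [eval_sub, eval_mul, eval_C] at h0
    have h1 : ‖Q.eval z‖ = ‖w‖ * ‖P.eval z‖ := by
      rw [sub_eq_zero.mp h0, norm_mul, Complex.norm_conj]
    have h2 := hPQ z hz
    have h3 := norm_pos_iff.mpr (hQ0 z hz)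
    nlinarith [norm_nonneg w]
  · intro z hz
    have hzz : z * conj z = 1 := by rw [Complex.mul_conj, Complex.normSq_eq_norm_sq, hz]; simp
    have hzd : z ^ d * conj z ^ d = 1 := by rw [← mul_pow, hzz, one_pow]
    have h1 := hrel z hz
    have h2 : conj (Q.eval z) = conj u * conj z ^ d * P.eval z := by
      rw [h1]; simp
    simp only [eval_sub, eval_mul, eval_C, map_sub, map_mul]
    rw [h2, h1]
    linear_combination (conj w * P.eval z * z ^ d * conj z ^ d) * huu +
      (conj w * P.eval z) * hzd
  · intro z hz
    have h := hQ0 z hz.le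
    simp only [eval_sub, eval_mul, eval_C, diskAut, hB z hz]
    rw [show P.eval z / Q.eval z - w = (P.eval z - w * Q.eval z) / Q.eval z by field_simp,
      show 1 - conj w * (P.eval z / Q.eval z) = (Q.eval z - conj w * P.eval z) / Q.eval z by
        field_simp, div_div_div_cancel_right₀ h]

theorem IsBlaschkeProduct.comp_diskAut (hB : IsBlaschkeProduct d B) (hw : ‖w‖ < 1) :
    IsBlaschkeProduct d fun z => B (diskAut w z) := by
  obtain ⟨u, a, hu, ha, hB⟩ := isBlaschkeProduct_iff.mp hB
  have hw' : ‖-w‖ < 1 := by simpa using hw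
  have hv : ∀ j, 1 + conj w * a j ≠ 0 := fun j => by
    simpa using one_sub_conj_mul_ne_zero hw' (ha j).le
  have hv' : ∀ j, conj (1 + conj w * a j) ≠ 0 := fun j => by
    rw [Ne, map_eq_zero]; exact hv j
  refine isBlaschkeProduct_iff.mpr ⟨u * ∏ j, (1 + conj w * a j) / conj (1 + conj w * a j),
    fun j => diskAut (-w) (a j), ?_, fun j => norm_diskAut_lt_one hw' (ha j), fun z hz => ?_⟩
  · rw [norm_mul, hu, one_mul, norm_prod]
    refine Finset.prod_eq_one fun j _ => ?_
    rw [norm_div, Complex.norm_conj, div_self (norm_ne_zero_iff.mpr (hv j))]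
  · rw [hB _ (norm_diskAut_lt_one hw hz), mul_assoc, ← Finset.prod_mul_distrib]
    congr 1
    refine Finset.prod_congr rfl fun j _ => ?_
    have hz' := one_sub_conj_mul_ne_zero hw hz.le
    have e : diskAut (-w) (a j) = (a j + w) / (1 + conj w * a j) := by
      simp [diskAut]
    have e1 : diskAut w z - a j =
        (1 + conj w * a j) * (z - diskAut (-w) (a j)) / (1 - conj w * z) := by
      rw [e, mul_sub, mul_div_cancel₀ _ (hv j), diskAut, eq_div_iff hz', sub_mul,
        div_mul_cancel₀ _ hz']
      ring
    have e2 : 1 - conj (a j) * diskAut w z =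
        conj (1 + conj w * a j) * (1 - conj (diskAut (-w) (a j)) * z) / (1 - conj w * z) := by
      rw [e, map_div₀, mul_sub, ← mul_assoc, mul_div_cancel₀ _ (hv' j), diskAut, eq_div_iff hz',
        sub_mul, mul_assoc, div_mul_cancel₀ _ hz']
      simp only [map_add, map_mul, map_one, Complex.conj_conj]
      ring
    rw [e1, e2, div_div_div_cancel_right₀ hz', mul_div_mul_comm]

theorem IsBlaschkeProduct.id_mul (hB : IsBlaschkeProduct d h) :
    IsBlaschkeProduct (d + 1) fun z => z * h z := by
  obtain ⟨u, a, hu, ha, hB⟩ := isBlaschkeProduct_iff.mp hB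
  refine isBlaschkeProduct_iff.mpr ⟨u, Fin.cons 0 a, hu, fun j => ?_, fun z hz => ?_⟩
  · refine Fin.cases ?_ (fun i => ?_) j
    · simp
    · simpa using ha i
  · rw [Fin.prod_univ_succ]
    simp only [Fin.cons_zero, Fin.cons_succ, hB z hz]
    simp only [sub_zero, map_zero, zero_mul, div_one]
    ring

theorem IsBlaschkeProduct.of_id_mul (hB : IsBlaschkeProduct (d + 1) fun z => z * h z)
    (hc : ContinuousAt h 0) : IsBlaschkeProduct d h := by
  obtain ⟨u, a, hu, ha, hB⟩ := isBlaschkeProduct_iff.mp hB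
  have hu0 : u ≠ 0 := by rintro rfl; simp at hu
  have h0 := hB 0 (by simp)
  rw [zero_mul, eq_comm, mul_eq_zero, or_iff_right hu0, Finset.prod_eq_zero_iff] at h0
  obtain ⟨p, -, hp⟩ := h0
  have hp0 : a p = 0 := by simpa using hp
  have hne : ∀ z, ‖z‖ < 1 → z ≠ 0 →
      h z = u * ∏ j, (z - a (p.succAbove j)) / (1 - conj (a (p.succAbove j)) * z) := by
    intro z hz hz0
    have := hB z hz
    rw [Fin.prod_univ_succAbove _ p, hp0] at this
    simp only [sub_zero, map_zero, zero_mul, div_one] at this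
    exact mul_left_cancel₀ hz0 (this.trans (by ring))
  refine isBlaschkeProduct_iff.mpr ⟨u, fun j => a (p.succAbove j), hu, fun j => ha _,
    fun z hz => ?_⟩
  by_cases hz0 : z = 0
  · subst hz0
    -- Cancelling `z` says nothing at the origin; the value of `h` there comes from continuity.
    have hcont : ContinuousAt
        (fun z => u * ∏ j, (z - a (p.succAbove j)) / (1 - conj (a (p.succAbove j)) * z)) 0 := by
      refine continuousAt_const.mul (tendsto_finsetProd _ fun j _ => ?_)
      exact ContinuousAt.div (by fun_prop) (by fun_prop) (by simp)
    refine tendsto_nhds_unique (hc.tendsto.mono_left (nhdsWithin_le_nhds (s := {0}ᶜ)))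
      ((hcont.tendsto.mono_left nhdsWithin_le_nhds).congr' ?_)
    filter_upwards [self_mem_nhdsWithin, nhdsWithin_le_nhds (ball_mem_nhds (0 : ℂ) one_pos)]
      with z hz hz1
    exact (hne z (by simpa using hz1) hz).symm
  · exact hne z hz hz0

theorem isBlaschkeProduct_pow_mul_iff (k : ℕ) (hc : ContinuousAt h 0) :
    IsBlaschkeProduct (d + k) (fun z => z ^ k * h z) ↔ IsBlaschkeProduct d h := by
  induction k with
  | zero => simp
  | succ k ih =>
    rw [← ih, ← add_assoc]
    have e : (fun z => z ^ (k + 1) * h z) = fun z => z * (z ^ k * h z) := by ext z; ring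
    rw [e]
    exact ⟨fun H => H.of_id_mul (by fun_prop), fun H => H.id_mul⟩

end Blaschke

/-! ### The boundary inequality for `h` and its equality case. -/

section BoundaryInterpolation

open Metric Filter Topology ComplexConjugate Polynomial

variable {n : ℕ} {ζ : Fin n → ℂ} {c : Fin n → ℝ} {h : ℂ → ℂ}

/-- The common denominator of the Herglotz kernels with poles `ζ j`. -/
noncomputable def poleDenom (ζ : Fin n → ℂ) : ℂ[X] := ∏ j, (C (ζ j) - X)

/-- The numerator of `∑ j, c j * herglotz (ζ j)` over the common denominator. -/
noncomputable def poleNumer (ζ : Fin n → ℂ) (c : Fin n → ℝ) : ℂ[X] :=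
  ∑ j, C (c j : ℂ) * ((C (ζ j) + X) * ∏ i ∈ Finset.univ.erase j, (C (ζ i) - X))

theorem eval_poleDenom (ζ : Fin n → ℂ) (z : ℂ) : (poleDenom ζ).eval z = ∏ j, (ζ j - z) := by
  simp [poleDenom, eval_prod]

theorem eval_poleNumer (ζ : Fin n → ℂ) (c : Fin n → ℝ) (z : ℂ) : (poleNumer ζ c).eval z =
    ∑ j, (c j : ℂ) * ((ζ j + z) * ∏ i ∈ Finset.univ.erase j, (ζ i - z)) := by
  simp [poleNumer, eval_prod, eval_finsetSum]

theorem natDegree_C_sub_X_le (a : ℂ) : (C a - X).natDegree ≤ 1 := by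
  refine (natDegree_sub_le _ _).trans ?_
  simp

theorem natDegree_poleDenom_le (ζ : Fin n → ℂ) : (poleDenom ζ).natDegree ≤ n := by
  refine (natDegree_prod_le _ _).trans ?_
  exact (Finset.sum_le_card_nsmul _ _ 1 fun j _ => natDegree_C_sub_X_le _).trans (by simp)

theorem natDegree_poleNumer_le (ζ : Fin n → ℂ) (c : Fin n → ℝ) :
    (poleNumer ζ c).natDegree ≤ n := by
  refine natDegree_sum_le_of_forall_le _ _ fun j _ => (natDegree_C_mul_le _ _).trans ?_
  refine natDegree_mul_le.trans ?_
  have h1 : (C (ζ j) + X).natDegree ≤ 1 := (natDegree_add_le _ _).trans (by simp)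
  have h2 : (∏ i ∈ Finset.univ.erase j, (C (ζ i) - X)).natDegree ≤ n - 1 := by
    refine (natDegree_prod_le _ _).trans ?_
    exact (Finset.sum_le_card_nsmul _ _ 1 fun j _ => natDegree_C_sub_X_le _).trans (by simp)
  have : 0 < n := j.pos
  omega

theorem eval_poleNumer_eq {z : ℂ} (hz : ∀ j, ζ j - z ≠ 0) : (poleNumer ζ c).eval z =
    (poleDenom ζ).eval z * ∑ j, c j * herglotz (ζ j) z := by
  rw [eval_poleNumer, eval_poleDenom, Finset.mul_sum]
  refine Finset.sum_congr rfl fun j _ => ?_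
  have := hz j
  rw [← Finset.mul_prod_erase _ _ (Finset.mem_univ j), herglotz]
  field_simp

theorem eval_poleNumer_pole (j : Fin n) : (poleNumer ζ c).eval (ζ j) =
    c j * (2 * ζ j * ∏ i ∈ Finset.univ.erase j, (ζ i - ζ j)) := by
  rw [eval_poleNumer, Finset.sum_eq_single j]
  · ring
  · intro i _ hij
    rw [Finset.prod_eq_zero (Finset.mem_erase.mpr ⟨hij.symm, Finset.mem_univ j⟩) (sub_self _)]
    simp
  · simp

theorem mul_conj_eq_one {z : ℂ} (hz : ‖z‖ = 1) : z * conj z = 1 := by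
  rw [Complex.mul_conj, Complex.normSq_eq_norm_sq, hz]; simp

theorem mul_conj_sub {a z : ℂ} (ha : ‖a‖ = 1) (hz : ‖z‖ = 1) :
    z * conj (a - z) = -conj a * (a - z) := by
  rw [map_sub]
  linear_combination mul_conj_eq_one ha - mul_conj_eq_one hz

theorem pow_mul_conj_poleDenom (hζ : ∀ j, ‖ζ j‖ = 1) {z : ℂ} (hz : ‖z‖ = 1) :
    z ^ n * conj ((poleDenom ζ).eval z) = (∏ j, -conj (ζ j)) * (poleDenom ζ).eval z := by
  have : z ^ n = ∏ _j : Fin n, z := by simp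
  rw [eval_poleDenom, map_prod, this, ← Finset.prod_mul_distrib, ← Finset.prod_mul_distrib]
  exact Finset.prod_congr rfl fun j _ => mul_conj_sub (hζ j) hz

theorem pow_mul_conj_poleNumer (hζ : ∀ j, ‖ζ j‖ = 1) {z : ℂ} (hz : ‖z‖ = 1) :
    z ^ n * conj ((poleNumer ζ c).eval z) = -((∏ j, -conj (ζ j)) * (poleNumer ζ c).eval z) := by
  have hn : z ^ n = ∏ _j : Fin n, z := by simp
  rw [eval_poleNumer, map_sum, Finset.mul_sum, Finset.mul_sum, ← Finset.sum_neg_distrib]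
  refine Finset.sum_congr rfl fun j _ => ?_
  have h1 : (∏ i ∈ Finset.univ.erase j, z) * conj (∏ i ∈ Finset.univ.erase j, (ζ i - z)) =
      (∏ i ∈ Finset.univ.erase j, -conj (ζ i)) * ∏ i ∈ Finset.univ.erase j, (ζ i - z) := by
    rw [map_prod, ← Finset.prod_mul_distrib, ← Finset.prod_mul_distrib]
    exact Finset.prod_congr rfl fun i _ => mul_conj_sub (hζ i) hz
  have h2 : z * conj (ζ j + z) = conj (ζ j) * (ζ j + z) := by
    rw [map_add]
    linear_combination mul_conj_eq_one hz - mul_conj_eq_one (hζ j)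
  rw [hn, ← Finset.mul_prod_erase _ (fun _ => z) (Finset.mem_univ j),
    ← Finset.mul_prod_erase _ (fun i => -conj (ζ i)) (Finset.mem_univ j)]
  rw [map_mul, map_mul, Complex.conj_ofReal]
  calc _ = c j * (z * conj (ζ j + z)) * ((∏ i ∈ Finset.univ.erase j, z) *
        conj (∏ i ∈ Finset.univ.erase j, (ζ i - z))) := by ring
    _ = _ := by rw [h1, h2]; ring

theorem eq_C_mul_poleDenom (hinj : Function.Injective ζ) {R : ℂ[X]} (hd : R.natDegree ≤ n)
    (hR : ∀ j, R.eval (ζ j) = 0) : ∃ κ : ℂ, R = C κ * poleDenom ζ := by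
  have hdvd : (∏ j, (X - C (ζ j))) ∣ R := by
    refine Finset.prod_dvd_of_coprime ?_ fun j _ => dvd_iff_isRoot.mpr (hR j)
    exact (pairwise_coprime_X_sub_C hinj).set_pairwise _
  have hmonic : (∏ j, (X - C (ζ j))).Monic := monic_prod_of_monic _ _ fun j _ => monic_X_sub_C _
  have hdeg : (∏ j, (X - C (ζ j))).natDegree = n := by
    rw [natDegree_prod_of_monic _ _ fun j _ => monic_X_sub_C _]; simp
  obtain ⟨S, hS⟩ := hdvd
  have hS0 : S.natDegree = 0 := by
    by_cases h0 : S = 0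
    · simp [h0]
    · rw [hS, hmonic.natDegree_mul' h0, hdeg] at hd
      omega
  have hneg : poleDenom ζ = C ((-1) ^ n) * ∏ j, (X - C (ζ j)) := by
    have : ∀ j, C (ζ j) - X = (-1) * (X - C (ζ j)) := fun j => by ring
    simp only [poleDenom, this, Finset.prod_mul_distrib, Finset.prod_const, Finset.card_univ,
      Fintype.card_fin, C_pow, C_neg, C_1]
  refine ⟨S.coeff 0 * (-1) ^ n, ?_⟩
  rw [hS, hneg, ← mul_assoc, ← C_mul, mul_assoc, ← mul_pow, mul_comm]
  conv_lhs => rw [eq_C_of_natDegree_eq_zero hS0]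
  simp

/-- Clearing denominators gives `h = (E - D) / (E + D)` with `D = poleDenom ζ`. On the circle, `z ^
n * conj` multiplies `D` by `v` and `E` by `-v`, so it exchanges `E - D` and `E + D` up to a
unimodular factor. -/
theorem isBlaschkeProduct_of_cayley_eq (hζ : ∀ j, ‖ζ j‖ = 1) (hinj : Function.Injective ζ)
    (hc : ∀ j, 0 < c j) (h1 : ∀ z, ‖z‖ < 1 → h z ≠ 1) (α : ℝ)
    (hF : ∀ z, ‖z‖ < 1 →
      (1 + h z) / (1 - h z) = α * Complex.I + ∑ j, c j * herglotz (ζ j) z) :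
    IsBlaschkeProduct n h := by
  set v : ℂ := ∏ j, -conj (ζ j) with hv
  have hvn : ‖v‖ = 1 := by
    rw [hv, norm_prod]
    exact Finset.prod_eq_one fun j _ => by rw [norm_neg, Complex.norm_conj, hζ]
  set E : ℂ[X] := C (α * Complex.I) * poleDenom ζ + poleNumer ζ c with hE
  have hEe : ∀ z, E.eval z =
      α * Complex.I * (poleDenom ζ).eval z + (poleNumer ζ c).eval z := by
    intro z; simp [hE]
  have hEd : E.natDegree ≤ n :=
    (natDegree_add_le _ _).trans (max_le ((natDegree_C_mul_le _ _).trans (natDegree_poleDenom_le ζ))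
      (natDegree_poleNumer_le ζ c))
  have hEz : ∀ z, (∀ j, ζ j - z ≠ 0) → E.eval z =
      (poleDenom ζ).eval z * (α * Complex.I + ∑ j, c j * herglotz (ζ j) z) := by
    intro z hz
    rw [hEe, eval_poleNumer_eq hz]; ring
  have hD0 : ∀ z, (∀ j, ζ j - z ≠ 0) → (poleDenom ζ).eval z ≠ 0 := by
    intro z hz
    rw [eval_poleDenom]
    exact Finset.prod_ne_zero_iff.mpr fun j _ => hz j
  -- At a pole only one term of the numerator survives, and it is nonzero since `c j > 0` and the
  -- poles are distinct. Elsewhere, after division by `D`, the real part is at least `1`.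
  have hQ : ∀ z, ‖z‖ ≤ 1 → (E + poleDenom ζ).eval z ≠ 0 := by
    intro z hz
    rw [eval_add]
    by_cases hex : ∃ j, ζ j - z = 0
    · obtain ⟨j, hj⟩ := hex
      obtain rfl := sub_eq_zero.mp hj
      have hDj : (poleDenom ζ).eval (ζ j) = 0 := by
        rw [eval_poleDenom]
        exact Finset.prod_eq_zero (Finset.mem_univ j) (sub_self _)
      rw [hEe, hDj, eval_poleNumer_pole, mul_zero, zero_add, add_zero]
      have hj0 : ζ j ≠ 0 := by
        intro h0; have := hζ j; rw [h0] at this; simp at this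
      refine mul_ne_zero (by exact_mod_cast (hc j).ne') (mul_ne_zero (mul_ne_zero two_ne_zero hj0)
        (Finset.prod_ne_zero_iff.mpr fun i hi => sub_ne_zero.mpr fun hij => ?_))
      exact (Finset.mem_erase.mp hi).1 (hinj hij)
    · push Not at hex
      rw [hEz z hex, ← mul_add_one]
      refine mul_ne_zero (hD0 z hex) fun h0 => ?_
      have hre := congrArg Complex.re h0
      have hs : 0 ≤ ∑ j, c j * (herglotz (ζ j) z).re := by
        refine Finset.sum_nonneg fun j _ => mul_nonneg (hc j).le ?_
        rw [herglotz_re (hζ j)]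
        exact div_nonneg (by nlinarith [norm_nonneg z]) (sq_nonneg _)
      simp [Complex.re_sum] at hre
      linarith
  refine isBlaschkeProduct_of_polynomial (P := E - poleDenom ζ) (Q := E + poleDenom ζ)
    (u := -conj v) (by simpa using hvn)
    ((natDegree_sub_le _ _).trans (max_le hEd (natDegree_poleDenom_le ζ))) hQ
    (fun z hz => ?_) (fun z hz => ?_)
  · have e1 := pow_mul_conj_poleDenom hζ hz
    have e2 := pow_mul_conj_poleNumer (c := c) hζ hz
    rw [← hv] at e1 e2
    have hvv := mul_conj_eq_one hvn
    rw [eval_add, eval_sub, hEe, map_sub, map_add, map_mul, map_mul, Complex.conj_ofReal,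
      Complex.conj_I]
    linear_combination (conj v * (α * Complex.I + 1)) * (-e1) + conj v * e2 -
      ((poleNumer ζ c).eval z + α * Complex.I * (poleDenom ζ).eval z + (poleDenom ζ).eval z) * hvv
  · have hz' : ∀ j, ζ j - z ≠ 0 := fun j => sub_ne_zero_of_norm (hζ j) hz
    have hh : 1 - h z ≠ 0 := sub_ne_zero.mpr (h1 z hz).symm
    have hQz := hQ z hz.le
    rw [eval_add, hEz z hz', ← hF z hz] at hQz
    rw [eval_add, eval_sub, hEz z hz', ← hF z hz]
    rw [eq_div_iff hQz]
    field_simp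
    ring

/-- Write `h = P / Q`. Since `Q - P` has degree at most `n` and vanishes at the `n` points `ζ j`, it
is a multiple of `poleDenom ζ`. Over this denominator the difference has a numerator `R` which
vanishes at every `ζ j` too, because the residues agree; hence the difference is constant. -/
theorem IsBlaschkeProduct.re_cayley_sub_eq_zero (hB : IsBlaschkeProduct n h)
    (hζ : ∀ j, ‖ζ j‖ = 1) (hinj : Function.Injective ζ) (h1 : ∀ z, ‖z‖ < 1 → h z ≠ 1)
    (hone : ∀ j, Tendsto (fun r : ℝ => h (r * ζ j)) (𝓝[<] 1) (𝓝 1))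
    (hlim : ∀ j, Tendsto (fun r : ℝ => (1 - r : ℂ) * ((1 + h (r * ζ j)) / (1 - h (r * ζ j))))
      (𝓝[<] 1) (𝓝 (2 * c j))) {z : ℂ} (hz : ‖z‖ < 1) :
    ((1 + h z) / (1 - h z) - ∑ j, c j * herglotz (ζ j) z).re = 0 := by
  obtain ⟨P, Q, u, hu, hP, hQ, hQ0, hPQ, hrel, hB⟩ := hB.exists_polynomial
  have hray : ∀ j, Tendsto (fun r : ℝ => (r : ℂ) * ζ j) (𝓝[<] 1) (𝓝 (ζ j)) := by
    intro j
    have : Continuous fun r : ℝ => (r : ℂ) * ζ j := by fun_prop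
    simpa using (this.tendsto 1).mono_left nhdsWithin_le_nhds
  have hpoly : ∀ (R : ℂ[X]) j, Tendsto (fun r : ℝ => R.eval (r * ζ j)) (𝓝[<] 1)
      (𝓝 (R.eval (ζ j))) := fun R j => (R.continuous.tendsto _).comp (hray j)
  have hN : ∀ j, (Q - P).eval (ζ j) = 0 := by
    intro j
    have hq := hQ0 (ζ j) (hζ j).le
    have := tendsto_nhds_unique (((hpoly P j).div (hpoly Q j) hq).congr'
      (eventually_Ioo_zero_one.mono fun r hr => (hB _ (norm_ofReal_mul_lt_one (hζ j) hr)).symm))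
      (hone j)
    rw [div_eq_one_iff_eq hq] at this
    rw [eval_sub, this, sub_self]
  obtain ⟨κ, hκ⟩ := eq_C_mul_poleDenom hinj
    ((natDegree_sub_le _ _).trans (max_le hQ hP)) hN
  have hκe : ∀ z, Q.eval z - P.eval z = κ * (poleDenom ζ).eval z := by
    intro z; rw [← eval_sub, hκ]; simp
  have hQP : ∀ z, ‖z‖ < 1 → Q.eval z - P.eval z ≠ 0 := by
    intro z hz h0
    apply h1 z hz
    rw [hB z hz, sub_eq_zero.mp h0, div_self]
    rw [← sub_eq_zero.mp h0]; exact hQ0 z hz.le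
  have hκ0 : κ ≠ 0 := by
    rintro rfl
    exact hQP 0 (by simp) (by rw [hκe]; simp)
  have hFe : ∀ z, ‖z‖ < 1 → (1 + h z) / (1 - h z) = (Q.eval z + P.eval z) /
      (κ * (poleDenom ζ).eval z) := by
    intro z hz
    have hq := hQ0 z hz.le
    rw [← hκe, hB z hz, one_add_div hq, one_sub_div hq, div_div_div_cancel_right₀ hq]
  have hD0 : ∀ z, ‖z‖ < 1 → (poleDenom ζ).eval z ≠ 0 := by
    intro z hz h0
    apply hQP z hz
    rw [hκe, h0, mul_zero]
  set R : ℂ[X] := C κ⁻¹ * (Q + P) - poleNumer ζ c with hR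
  have hRe : ∀ z, R.eval z = κ⁻¹ * (Q.eval z + P.eval z) - (poleNumer ζ c).eval z := by
    intro z; simp [hR]
  have hRd : R.natDegree ≤ n := (natDegree_sub_le _ _).trans (max_le
    ((natDegree_C_mul_le _ _).trans ((natDegree_add_le _ _).trans (max_le hQ hP)))
    (natDegree_poleNumer_le ζ c))
  have hRG : ∀ z, ‖z‖ < 1 → R.eval z = (poleDenom ζ).eval z *
      ((1 + h z) / (1 - h z) - ∑ j, c j * herglotz (ζ j) z) := by
    intro z hz
    have hd := hD0 z hz
    rw [hRe, eval_poleNumer_eq fun j => sub_ne_zero_of_norm (hζ j) hz, hFe z hz, mul_sub]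
    field_simp
  have hRζ : ∀ j, R.eval (ζ j) = 0 := by
    intro j
    have hG : Tendsto (fun r : ℝ => (1 - r : ℂ) * ((1 + h (r * ζ j)) / (1 - h (r * ζ j)) -
        ∑ i, c i * herglotz (ζ i) (r * ζ j))) (𝓝[<] 1) (𝓝 0) := by
      have hs : ∀ i, Tendsto (fun r : ℝ => (1 - r : ℂ) * (c i * herglotz (ζ i) (r * ζ j)))
          (𝓝[<] 1) (𝓝 (if i = j then 2 * c j else 0)) := by
        intro i
        split_ifs with hij
        · subst hij
          have : Tendsto (fun r : ℝ => (c i : ℂ) * (1 + r)) (𝓝[<] 1) (𝓝 (c i * (1 + (1 : ℝ)))) :=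
            (Continuous.tendsto (by fun_prop) 1).mono_left nhdsWithin_le_nhds
          rw [show (c i * (1 + (1 : ℝ)) : ℂ) = 2 * c i by push_cast; ring] at this
          refine this.congr' ?_
          filter_upwards [eventually_Ioo_zero_one] with r hr
          rw [← one_sub_mul_herglotz_self (hζ i) hr]
          ring
        · have := (tendsto_one_sub_mul_herglotz_of_ne (ζ := ζ j) (η := ζ i)
            fun h => hij (hinj h.symm)).const_mul (c i : ℂ)
          rw [mul_zero] at this
          exact this.congr fun r => by ring
      have := (hlim j).sub (tendsto_finsetSum Finset.univ fun i _ => hs i)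
      simp only [Finset.sum_ite_eq', Finset.mem_univ, if_true, sub_self] at this
      exact this.congr fun r => by rw [mul_sub, Finset.mul_sum]
    -- At `r * ζ j` the common denominator is `(1 - r)` times this expression.
    have hE : Tendsto (fun r : ℝ => ζ j * ∏ i ∈ Finset.univ.erase j, (ζ i - r * ζ j)) (𝓝[<] 1)
        (𝓝 (ζ j * ∏ i ∈ Finset.univ.erase j, (ζ i - (1 : ℝ) * ζ j))) :=
      (Continuous.tendsto (by fun_prop) 1).mono_left nhdsWithin_le_nhds
    have hEG := hE.mul hG
    rw [mul_zero] at hEG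
    refine tendsto_nhds_unique (hpoly R j) (hEG.congr' ?_)
    filter_upwards [eventually_Ioo_zero_one] with r hr
    rw [hRG _ (norm_ofReal_mul_lt_one (hζ j) hr), eval_poleDenom,
      ← Finset.mul_prod_erase _ _ (Finset.mem_univ j)]
    ring
  obtain ⟨γ, hγ⟩ := eq_C_mul_poleDenom hinj hRd hRζ
  have hγe : ∀ z, R.eval z = γ * (poleDenom ζ).eval z := by intro z; rw [hγ]; simp
  have hG : (1 + h z) / (1 - h z) - ∑ j, c j * herglotz (ζ j) z = γ := by
    have := hRG z hz
    rw [hγe, mul_comm] at this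
    exact (mul_left_cancel₀ (hD0 z hz) this).symm
  rw [hG]
  -- The constant is evaluated at a point of the circle that is not a pole, where the Cayley
  -- transform and all the kernels are purely imaginary.
  obtain ⟨w, hw, hwζ⟩ := (infinite_unit_sphere.sdiff (Set.finite_range ζ)).nonempty
  rw [mem_sphere_zero_iff_norm] at hw
  have hwj : ∀ j, ζ j - w ≠ 0 := fun j h0 => hwζ ⟨j, sub_eq_zero.mp h0⟩
  have hDw : (poleDenom ζ).eval w ≠ 0 := by
    rw [eval_poleDenom]
    exact Finset.prod_ne_zero_iff.mpr fun j _ => hwj j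
  have hnorm : ‖Q.eval w‖ = ‖P.eval w‖ := by simp [hrel w hw, hu, hw]
  have hγw : γ = (Q.eval w + P.eval w) / (Q.eval w - P.eval w) -
      ∑ j, c j * herglotz (ζ j) w := by
    have := hRe w
    rw [hγe, eval_poleNumer_eq hwj] at this
    rw [hκe]
    field_simp
    field_simp at this
    linear_combination this
  rw [hγw, Complex.sub_re, re_add_div_sub, hnorm, Complex.re_sum]
  simp [herglotz_re (hζ _), diskPoisson, hw]

theorem cayley_re (w : ℂ) : ((1 + w) / (1 - w)).re = (1 - ‖w‖ ^ 2) / ‖1 - w‖ ^ 2 := by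
  simpa using re_add_div_sub 1 w

/-- Boundary Schwarz–Pick inequality at finitely many fixed boundary values `1`, with the equality
case. -/
theorem sum_boundary_le (hh : DifferentiableOn ℂ h (ball 0 1))
    (hmaps : Set.MapsTo h (ball 0 1) (ball 0 1)) (hζ : ∀ j, ‖ζ j‖ = 1)
    (hinj : Function.Injective ζ) (hc : ∀ j, 0 < c j)
    (hlim : ∀ j, Tendsto (fun r : ℝ => (1 - r : ℂ) / (1 - h (r * ζ j))) (𝓝[<] 1) (𝓝 (c j))) :
    ∑ j, c j ≤ (1 - ‖h 0‖ ^ 2) / ‖1 - h 0‖ ^ 2 ∧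
    (∑ j, c j = (1 - ‖h 0‖ ^ 2) / ‖1 - h 0‖ ^ 2 ↔ IsBlaschkeProduct n h) := by
  have hlt : ∀ z, ‖z‖ < 1 → ‖h z‖ < 1 := fun z hz => by
    simpa using hmaps (mem_ball_zero_iff.mpr hz)
  have h1 : ∀ z, ‖z‖ < 1 → h z ≠ 1 := fun z hz h0 => by
    have := hlt z hz
    rw [h0] at this; simp at this
  have hsub : ∀ z, ‖z‖ < 1 → 1 - h z ≠ 0 := fun z hz => sub_ne_zero.mpr (h1 z hz).symm
  have hFd : DifferentiableOn ℂ (fun z => (1 + h z) / (1 - h z)) (ball 0 1) :=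
    (hh.const_add _).div (hh.const_sub _) fun z hz => hsub z (by simpa using hz)
  have hFre : ∀ z ∈ ball (0 : ℂ) 1, 0 ≤ ((1 + h z) / (1 - h z)).re := by
    intro z hz
    rw [cayley_re]
    have := hlt z (by simpa using hz)
    exact div_nonneg (by nlinarith [norm_nonneg (h z)]) (sq_nonneg _)
  have hone_sub : Tendsto (fun r : ℝ => (1 - r : ℂ)) (𝓝[<] 1) (𝓝 0) := by
    have : Continuous fun r : ℝ => (1 - r : ℂ) := by fun_prop
    simpa using (this.tendsto 1).mono_left nhdsWithin_le_nhds
  have hFlim : ∀ j, Tendsto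
      (fun r : ℝ => (1 - r : ℂ) * ((1 + h (r * ζ j)) / (1 - h (r * ζ j)))) (𝓝[<] 1)
      (𝓝 (2 * c j)) := by
    intro j
    have := ((hlim j).const_mul 2).sub hone_sub
    rw [sub_zero] at this
    refine this.congr' ?_
    filter_upwards [eventually_Ioo_zero_one] with r hr
    have := hsub _ (norm_ofReal_mul_lt_one (hζ j) hr)
    field_simp
    ring
  have hone : ∀ j, Tendsto (fun r : ℝ => h (r * ζ j)) (𝓝[<] 1) (𝓝 1) := by
    intro j
    have := (hone_sub.div (hlim j) (by exact_mod_cast (hc j).ne')).const_sub 1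
    rw [zero_div, sub_zero] at this
    refine this.congr' ?_
    filter_upwards [eventually_Ioo_zero_one] with r hr
    have := hsub _ (norm_ofReal_mul_lt_one (hζ j) hr)
    have hr1 : (1 - r : ℂ) ≠ 0 := by exact_mod_cast (by linarith [hr.2] : (1 - r : ℝ) ≠ 0)
    rw [Pi.div_apply, div_div_cancel₀ hr1]
    ring
  have hre := re_sub_sum_herglotz_nonneg hFd hFre hζ hinj hFlim Finset.univ
  have hG0 : ((1 + h 0) / (1 - h 0) - ∑ j, c j * herglotz (ζ j) 0).re =
      (1 - ‖h 0‖ ^ 2) / ‖1 - h 0‖ ^ 2 - ∑ j, c j := by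
    rw [Complex.sub_re, cayley_re, Complex.re_sum]
    congr 1
    refine Finset.sum_congr rfl fun j _ => ?_
    rw [Complex.re_ofReal_mul, herglotz_re (hζ j), diskPoisson]
    simp [hζ j]
  have h00 := hre 0 (by simp)
  rw [hG0] at h00
  refine ⟨by linarith, fun heq => ?_, fun hB => ?_⟩
  · refine isBlaschkeProduct_of_cayley_eq hζ hinj hc h1
      ((1 + h 0) / (1 - h 0) - ∑ j, c j * herglotz (ζ j) 0).im fun z hz => ?_
    -- Based at `0`, where equality makes the real part zero, the Harnack bound forces the remainder
    -- to be constant.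
    have := norm_sub_le_of_re_nonneg (G := fun z => (1 + h z) / (1 - h z) -
      ∑ j, c j * herglotz (ζ j) z) (z₁ := 0)
      (hFd.sub (DifferentiableOn.fun_sum fun j _ =>
        (differentiableOn_herglotz (hζ j)).const_mul _)) hre (by simp) hz
    simp only [hG0, heq, sub_self, zero_mul] at this
    have := norm_le_zero_iff.mp this
    linear_combination this
  · have := hB.re_cayley_sub_eq_zero hζ hinj h1 hone hFlim (z := 0) (by simp)
    rw [hG0] at this
    linarith

end BoundaryInterpolation

/-! ### Dividing out the fixed point and transporting dilation coefficients. -/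

section FixedPoint

open Metric Filter Topology ComplexConjugate

theorem exists_pow_mul_eq_sub {f : ℂ → ℂ} {s : Set ℂ} {z₀ : ℂ} {k : ℕ} (hs : IsOpen s)
    (hf : DifferentiableOn ℂ f s) (hz₀ : z₀ ∈ s) (hk : 1 ≤ k)
    (hder : ∀ i, 1 ≤ i → i < k → iteratedDeriv i f z₀ = 0) :
    ∃ q : ℂ → ℂ, DifferentiableOn ℂ q s ∧ (∀ z, f z - f z₀ = (z - z₀) ^ k * q z) ∧
      q z₀ = iteratedDeriv k f z₀ / (k.factorial : ℂ) := by
  classical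
  set A := iteratedDeriv k f z₀ / (k.factorial : ℂ) with hA
  have hfa : AnalyticAt ℂ f z₀ := hf.analyticAt (hs.mem_nhds hz₀)
  have hpa : AnalyticAt ℂ (fun z => A * (z - z₀) ^ k) z₀ := by fun_prop
  set p : ℂ → ℂ := fun z => f z - f z₀ - A * (z - z₀) ^ k with hp
  have hpan : AnalyticAt ℂ p z₀ := (hfa.sub analyticAt_const).sub hpa
  have hpow : ∀ i, iteratedDeriv i (fun z => A * (z - z₀) ^ k) z₀ =
      A * if i = k then (k.factorial : ℂ) else 0 := by
    intro i
    rw [iteratedDeriv_const_mul_field, iteratedDeriv_comp_sub_const i (fun z : ℂ => z ^ k) z₀]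
    simp only [sub_self]
    rw [iteratedDeriv_fun_pow_zero]
    push_cast
    rfl
  -- The `k`-th Taylor term is subtracted as well, so the order is at least `k + 1`. Near `z₀` the
  -- quotient is then `A + (z - z₀) * g z`, which gives both differentiability and the value `A`.
  have hord : ((k + 1 : ℕ) : ℕ∞) ≤ analyticOrderAt p z₀ := by
    rw [natCast_le_analyticOrderAt_iff_iteratedDeriv_eq_zero hpan]
    intro i hi
    rw [hp, iteratedDeriv_fun_sub (f := fun z => f z - f z₀)
      (hfa.sub analyticAt_const).contDiffAt hpa.contDiffAt,
      iteratedDeriv_fun_sub hfa.contDiffAt contDiffAt_const, hpow, iteratedDeriv_const]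
    rcases Nat.eq_zero_or_pos i with rfl | hi0
    · simp [(Nat.one_le_iff_ne_zero.mp hk).symm]
    · rcases (Nat.lt_succ_iff.mp hi).eq_or_lt with rfl | hik
      · have : (i.factorial : ℂ) ≠ 0 := by exact_mod_cast i.factorial_ne_zero
        simp [hi0.ne', hA, this]
      · simp [hi0.ne', hik.ne, hder i hi0 hik]
  obtain ⟨g, hg, hgp⟩ := (natCast_le_analyticOrderAt hpan).mp hord
  refine ⟨fun z => if z = z₀ then A else (f z - f z₀) / (z - z₀) ^ k, fun z hz => ?_, fun z => ?_,
    by simp⟩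
  · by_cases hzz : z = z₀
    · subst hzz
      have : DifferentiableAt ℂ (fun w => A + (w - z) * g w) z :=
        ((differentiableAt_id.sub_const z).mul hg.differentiableAt).const_add A
      refine (this.congr_of_eventuallyEq ?_).differentiableWithinAt
      filter_upwards [hgp] with w hw
      split_ifs with hwz
      · simp [hwz]
      · have h0 : (w - z) ^ k ≠ 0 := pow_ne_zero _ (sub_ne_zero.mpr hwz)
        rw [div_eq_iff h0]
        simp only [hp, smul_eq_mul] at hw
        rw [sub_eq_iff_eq_add] at hw
        rw [hw]; ring
    · have hd : DifferentiableAt ℂ (fun w => (f w - f z₀) / (w - z₀) ^ k) z := by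
        have h0 : (z - z₀) ^ k ≠ 0 := pow_ne_zero _ (sub_ne_zero.mpr hzz)
        have := hf.differentiableAt (hs.mem_nhds hz)
        exact (this.sub_const _).div (by fun_prop) h0
      refine (hd.congr_of_eventuallyEq ?_).differentiableWithinAt
      filter_upwards [isOpen_ne.mem_nhds hzz] with w hw
      rw [if_neg hw]
  · beta_reduce
    split_ifs with hzz
    · subst hzz; simp [Nat.one_le_iff_ne_zero.mp hk]
    · rw [mul_div_cancel₀ _ (pow_ne_zero _ (sub_ne_zero.mpr hzz))]

/-- The maximum principle on the disk of radius `r` gives the bound `r ^ (-k)`; let `r → 1`. -/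
theorem norm_le_one_of_norm_pow_mul_le {h : ℂ → ℂ} {k : ℕ}
    (hh : DifferentiableOn ℂ h (ball 0 1)) (hle : ∀ z, ‖z‖ < 1 → ‖z ^ k * h z‖ ≤ 1)
    {w : ℂ} (hw : ‖w‖ < 1) : ‖h w‖ ≤ 1 := by
  have key : ∀ r : ℝ, r ∈ Set.Ioo ‖w‖ 1 → ‖h w‖ ≤ (r ^ k)⁻¹ := by
    intro r hr
    have hr0 : 0 < r := (norm_nonneg w).trans_lt hr.1
    refine Complex.norm_le_of_forall_mem_frontier_norm_le (U := ball 0 r) isBounded_ball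
      ((hh.mono (closedBall_subset_ball hr.2)).diffContOnCl_ball subset_rfl) (fun z hz => ?_)
      (subset_closure (by simpa using hr.1))
    rw [frontier_ball _ hr0.ne', mem_sphere_zero_iff_norm] at hz
    have := hle z (hz ▸ hr.2)
    rw [norm_mul, norm_pow, hz] at this
    rw [← one_div, le_div_iff₀ (pow_pos hr0 k), mul_comm]
    exact this
  have hl : Tendsto (fun r : ℝ => (r ^ k)⁻¹) (𝓝[<] 1) (𝓝 1) := by
    have : ContinuousAt (fun r : ℝ => (r ^ k)⁻¹) 1 :=
      ContinuousAt.inv₀ (by fun_prop) (by simp)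
    simpa using this.tendsto.mono_left nhdsWithin_le_nhds
  refine ge_of_tendsto hl ?_
  filter_upwards [Ioo_mem_nhdsLT hw] with r hr using key r hr

theorem isBlaschkeProduct_conj_iff {f : ℂ → ℂ} {d : ℕ} {a : ℂ} (ha : ‖a‖ < 1)
    (hmaps : Set.MapsTo f (ball 0 1) (ball 0 1)) :
    IsBlaschkeProduct d (fun w => diskAut a (f (diskAut (-a) w))) ↔ IsBlaschkeProduct d f := by
  have ha' : ‖-a‖ < 1 := by simpa using ha
  refine ⟨fun H => ((H.diskAut_comp ha').comp_diskAut ha).congr fun z hz => ?_,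
    fun H => (H.comp_diskAut ha').diskAut_comp ha⟩
  have hfz : ‖f z‖ < 1 := by simpa using hmaps (mem_ball_zero_iff.mpr hz)
  rw [diskAut_neg_diskAut ha hz.le, diskAut_neg_diskAut ha hfz.le]

/-- A self-map of the disk with a fixed point of multiplicity `k` is, up to conjugation by a disk
automorphism, `w ^ k` times a self-map of the disk, unless it is a Blaschke product of degree
`k`. -/
theorem exists_conj_eq_pow_mul {f : ℂ → ℂ} (hf : DifferentiableOn ℂ f (ball 0 1))
    (hmaps : Set.MapsTo f (ball 0 1) (ball 0 1)) {k : ℕ} (hk : 1 ≤ k)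
    (hB : ¬ IsBlaschkeProduct k f) {a : ℂ} (ha : ‖a‖ < 1) (hfix : f a = a)
    (hder : ∀ i, 1 ≤ i → i < k → iteratedDeriv i f a = 0) :
    ∃ h : ℂ → ℂ, DifferentiableOn ℂ h (ball 0 1) ∧ Set.MapsTo h (ball 0 1) (ball 0 1) ∧
      (∀ w, ‖w‖ < 1 → diskAut a (f (diskAut (-a) w)) = w ^ k * h w) ∧
      h 0 = iteratedDeriv k f a / (k.factorial : ℂ) * (1 - (‖a‖ : ℂ) ^ 2) ^ (k - 1) := by
  have ha' : ‖-a‖ < 1 := by simpa using ha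
  obtain ⟨q, hq, hfq, hqa⟩ :=
    exists_pow_mul_eq_sub isOpen_ball hf (mem_ball_zero_iff.mpr ha) hk hder
  have hfn : ∀ z, ‖z‖ < 1 → ‖f z‖ < 1 := fun z hz => by
    simpa using hmaps (mem_ball_zero_iff.mpr hz)
  set H : ℂ → ℂ := fun z => q z * (1 - conj a * z) ^ k / (1 - conj a * f z) with hH
  have hHd : DifferentiableOn ℂ H (ball 0 1) := by
    refine DifferentiableOn.div (hq.mul (by fun_prop)) ((hf.const_mul _).const_sub _) fun z hz => ?_
    exact one_sub_conj_mul_ne_zero ha (hfn z (by simpa using hz)).le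
  have hHf : ∀ z, ‖z‖ < 1 → diskAut a (f z) = diskAut a z ^ k * H z := by
    intro z hz
    have h1 := one_sub_conj_mul_ne_zero ha hz.le
    have h2 := hfq z
    rw [hfix] at h2
    rw [hH, diskAut, diskAut, h2, div_pow, div_mul_div_comm, mul_comm ((1 - conj a * z) ^ k),
      ← mul_assoc, mul_div_mul_right _ _ (pow_ne_zero k h1)]
  set h : ℂ → ℂ := fun w => H (diskAut (-a) w) with hh
  have hhd : DifferentiableOn ℂ h (ball 0 1) :=
    hHd.comp (differentiableOn_diskAut ha') (mapsTo_diskAut ha')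
  have hgh : ∀ w, ‖w‖ < 1 → diskAut a (f (diskAut (-a) w)) = w ^ k * h w := by
    intro w hw
    rw [hHf _ (norm_diskAut_lt_one ha' hw), diskAut_diskAut_neg ha hw.le]
  have hgd : DifferentiableOn ℂ (fun w => diskAut a (f (diskAut (-a) w))) (ball 0 1) :=
    (differentiableOn_diskAut ha).comp (hf.comp (differentiableOn_diskAut ha') (mapsTo_diskAut ha'))
      (hmaps.comp (mapsTo_diskAut ha'))
  have hle : ∀ w, ‖w‖ < 1 → ‖h w‖ ≤ 1 := fun w hw =>
    norm_le_one_of_norm_pow_mul_le (k := k) hhd (fun z hz => by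
      rw [← hgh z hz]
      exact (norm_diskAut_lt_one ha (hfn _ (norm_diskAut_lt_one ha' hz))).le) hw
  refine ⟨h, hhd, fun w hw => ?_, hgh, ?_⟩
  · rw [mem_ball_zero_iff] at hw ⊢
    refine (hle w hw).lt_of_ne fun heq => hB ?_
    -- If `h` attained modulus one it would be a unimodular constant, making `f` a Blaschke product
    -- of degree `k`.
    have hconst := Complex.eqOn_of_isPreconnected_of_isMaxOn_norm
      (convex_ball (0 : ℂ) 1).isPreconnected isOpen_ball hhd (mem_ball_zero_iff.mpr hw)
      (fun z hz => by
        have := hle z (by simpa using hz)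
        simpa [heq] using this)
    have h0 : IsBlaschkeProduct 0 h := isBlaschkeProduct_iff.mpr ⟨h w, Fin.elim0, heq,
      fun j => j.elim0, fun z hz => by simpa using hconst (mem_ball_zero_iff.mpr hz)⟩
    have hc : ContinuousAt h 0 :=
      (hhd.differentiableAt (ball_mem_nhds _ one_pos)).continuousAt
    have := (isBlaschkeProduct_pow_mul_iff k hc).mpr h0
    rw [zero_add] at this
    exact (isBlaschkeProduct_conj_iff ha hmaps).mp (this.congr hgh)
  · have e : (1 - conj a * a) = 1 - (‖a‖ : ℂ) ^ 2 := by rw [Complex.conj_mul']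
    have hne : 1 - (‖a‖ : ℂ) ^ 2 ≠ 0 := e ▸ one_sub_conj_mul_ne_zero ha ha.le
    obtain ⟨l, rfl⟩ : ∃ l, k = l + 1 := ⟨k - 1, by omega⟩
    simp only [hh, hH, diskAut_zero, neg_neg, hfix, hqa, e, Nat.add_sub_cancel]
    rw [pow_succ, ← mul_assoc, mul_div_assoc, div_self hne, mul_one]

theorem tendsto_ray (σ : ℂ) : Tendsto (fun r : ℝ => (r : ℂ) * σ) (𝓝[<] 1) (𝓝 σ) := by
  have : Continuous fun r : ℝ => (r : ℂ) * σ := by fun_prop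
  simpa using (this.tendsto 1).mono_left nhdsWithin_le_nhds

theorem HasNontangentialLimit.tendsto_radial {f : ℂ → ℂ} {σ τ : ℂ} (hσ : ‖σ‖ = 1)
    (h : HasNontangentialLimit f σ τ) :
    Tendsto (fun r : ℝ => f (r * σ)) (𝓝[<] 1) (𝓝 τ) := by
  refine (h 2 one_lt_two).comp (tendsto_nhdsWithin_iff.mpr ⟨tendsto_ray σ, ?_⟩)
  filter_upwards [eventually_Ioo_zero_one] with r hr
  have hn : ‖(r : ℂ) * σ‖ = r := by
    rw [norm_mul, hσ, mul_one, Complex.norm_real, Real.norm_of_nonneg hr.1.le]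
  have hn' : ‖σ - r * σ‖ = 1 - r := by
    rw [show σ - r * σ = ((1 - r : ℝ) : ℂ) * σ by push_cast; ring, norm_mul, hσ, mul_one,
      Complex.norm_real, Real.norm_of_nonneg (by linarith [hr.2])]
  refine ⟨by simpa [hn] using norm_ofReal_mul_lt_one hσ hr, ?_⟩
  rw [hn, hn', div_self (by linarith [hr.2])]
  exact one_lt_two

theorem dilation_quotient_eq (σ τ z w : ℂ) :
    (‖τ - w‖ ^ 2 / (1 - ‖w‖ ^ 2)) / (‖σ - z‖ ^ 2 / (1 - ‖z‖ ^ 2)) =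
      diskPoisson σ z / diskPoisson τ w := by
  simp only [diskPoisson, div_eq_mul_inv, mul_inv, inv_inv]
  ring

theorem diskPoisson_le_of_dilationCoeffAt {f : ℂ → ℂ} {σ τ : ℂ}
    (hmaps : Set.MapsTo f (ball 0 1) (ball 0 1)) (hτ : ‖τ‖ = 1)
    (hfin : dilationCoeffAt f σ τ ≠ ⊤) {z : ℂ} (hz : z ∈ ball (0 : ℂ) 1) :
    diskPoisson σ z ≤ (dilationCoeffAt f σ τ).toReal * diskPoisson τ (f z) := by
  have hp : 0 < diskPoisson τ (f z) := diskPoisson_pos hτ (by simpa using hmaps hz)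
  rw [← div_le_iff₀ hp, ← dilation_quotient_eq]
  refine (ENNReal.ofReal_le_iff_le_toReal hfin).mp ?_
  exact le_iSup₂ (f := fun z (_ : z ∈ ball (0 : ℂ) 1) => ENNReal.ofReal
    ((‖τ - f z‖ ^ 2 / (1 - ‖f z‖ ^ 2)) / (‖σ - z‖ ^ 2 / (1 - ‖z‖ ^ 2)))) z hz

theorem exists_lt_diskPoisson_of_lt_dilationCoeffAt {f : ℂ → ℂ} {σ τ : ℂ}
    (hmaps : Set.MapsTo f (ball 0 1) (ball 0 1)) (hσ : ‖σ‖ = 1) (hτ : ‖τ‖ = 1)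
    {b : ℝ} (hb : b < (dilationCoeffAt f σ τ).toReal) :
    ∃ z ∈ ball (0 : ℂ) 1, b * diskPoisson τ (f z) < diskPoisson σ z := by
  have hp : ∀ z ∈ ball (0 : ℂ) 1, 0 < diskPoisson τ (f z) := fun z hz =>
    diskPoisson_pos hτ (by simpa using hmaps hz)
  by_contra! hcon
  have hb0 : 0 ≤ b := by
    have h1 := hcon 0 (by simp)
    have h2 := diskPoisson_pos (z := 0) hσ (by simp)
    have h3 := hp 0 (by simp)
    by_contra! hneg
    nlinarith
  refine hb.not_ge (ENNReal.toReal_le_of_le_ofReal hb0 (iSup₂_le fun z hz => ?_))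
  rw [dilation_quotient_eq]
  exact ENNReal.ofReal_le_ofReal ((div_le_iff₀ (hp z hz)).mpr (hcon z hz))

/-- Along the radius, the inequality defining the coefficient yields `‖τ - f (r * σ)‖ ^ 2 ≤ b * (1 -
r)`. -/
theorem tendsto_radial_of_dilationCoeffAt_ne_top {f : ℂ → ℂ} {σ τ : ℂ}
    (hmaps : Set.MapsTo f (ball 0 1) (ball 0 1)) (hσ : ‖σ‖ = 1) (hτ : ‖τ‖ = 1)
    (hfin : dilationCoeffAt f σ τ ≠ ⊤) :
    Tendsto (fun r : ℝ => f (r * σ)) (𝓝[<] 1) (𝓝 τ) := by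
  set b := (dilationCoeffAt f σ τ).toReal
  have hb : 0 ≤ b := ENNReal.toReal_nonneg
  rw [tendsto_iff_norm_sub_tendsto_zero]
  have hsq : Tendsto (fun r : ℝ => √(b * (1 - r))) (𝓝[<] 1) (𝓝 0) := by
    have : Continuous fun r : ℝ => √(b * (1 - r)) := by fun_prop
    simpa using (this.tendsto 1).mono_left nhdsWithin_le_nhds
  refine squeeze_zero' (Eventually.of_forall fun r => norm_nonneg _) ?_ hsq
  filter_upwards [eventually_Ioo_zero_one] with r hr
  have hz : (r : ℂ) * σ ∈ ball (0 : ℂ) 1 := by simpa using norm_ofReal_mul_lt_one hσ hr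
  have h := diskPoisson_le_of_dilationCoeffAt hmaps hτ hfin hz
  have hfz : ‖f (r * σ)‖ < 1 := by simpa using hmaps hz
  have hn : ‖(r : ℂ) * σ‖ = r := by
    rw [norm_mul, hσ, mul_one, Complex.norm_real, Real.norm_of_nonneg hr.1.le]
  have hr1 : 0 < 1 - r := by linarith [hr.2]
  have hr0 := hr.1
  have hn' : ‖σ - r * σ‖ = 1 - r := by
    rw [show σ - r * σ = ((1 - r : ℝ) : ℂ) * σ by push_cast; ring, norm_mul, hσ, mul_one,
      Complex.norm_real, Real.norm_of_nonneg hr1.le]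
  have hpos : 0 < ‖τ - f (r * σ)‖ := norm_pos_iff.mpr (sub_ne_zero_of_norm hτ hfz)
  rw [norm_sub_rev]
  apply Real.le_sqrt_of_sq_le
  rw [diskPoisson, diskPoisson, hn, hn', show (1 - r ^ 2) / (1 - r) ^ 2 = (1 + r) / (1 - r) by
    field_simp; ring, ← mul_div_assoc, div_le_div_iff₀ hr1 (by positivity)] at h
  have h2 : b * (1 - ‖f (r * σ)‖ ^ 2) * (1 - r) ≤ b * (1 - r) := by
    have : b * (1 - ‖f (r * σ)‖ ^ 2) ≤ b * 1 := by
      gcongr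
      linarith [sq_nonneg ‖f (r * σ)‖]
    nlinarith
  nlinarith [sq_nonneg ‖τ - f (r * σ)‖]

/-- A finite coefficient at `τ'` makes `τ'` the radial limit, so only `τ` can compete in the
infimum. -/
theorem boundaryDilation_eq_dilationCoeffAt {f : ℂ → ℂ} {σ τ : ℂ}
    (hmaps : Set.MapsTo f (ball 0 1) (ball 0 1)) (hσ : ‖σ‖ = 1) (hτ : ‖τ‖ = 1)
    (hlim : HasNontangentialLimit f σ τ) : boundaryDilation f σ = dilationCoeffAt f σ τ := by
  refine le_antisymm (iInf₂_le τ (by simpa using hτ)) (le_iInf₂ fun τ' hτ' => ?_)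
  rw [mem_sphere_zero_iff_norm] at hτ'
  by_cases h : dilationCoeffAt f σ τ' = ⊤
  · rw [h]; exact le_top
  · rw [tendsto_nhds_unique (hlim.tendsto_radial hσ)
      (tendsto_radial_of_dilationCoeffAt_ne_top hmaps hσ hτ' h)]

theorem norm_one_sub_conj_mul_sq {a σ : ℂ} (hσ : ‖σ‖ = 1) :
    ‖1 - conj a * σ‖ ^ 2 = ‖σ - a‖ ^ 2 := by
  have := norm_sq_one_sub_conj_mul_sub a σ
  rw [hσ] at this
  linarith

/-- The conformal factor does not depend on `z`, so conjugation only rescales dilation coefficients.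
-/
theorem diskPoisson_diskAut {a σ z : ℂ} (ha : ‖a‖ < 1) (hσ : ‖σ‖ = 1) (hz : ‖z‖ < 1) :
    diskPoisson (diskAut a σ) (diskAut a z) =
      diskPoisson σ z * (‖σ - a‖ ^ 2 / (1 - ‖a‖ ^ 2)) := by
  have h1 := norm_pos_iff.mpr (one_sub_conj_mul_ne_zero ha hz.le)
  have h2 := norm_pos_iff.mpr (one_sub_conj_mul_ne_zero ha hσ.le)
  have h3 := norm_pos_iff.mpr (sub_ne_zero_of_norm hσ hz)
  have h4 : 0 < 1 - ‖a‖ ^ 2 := by nlinarith [norm_nonneg a]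
  have h5 : ‖1 - conj a * a‖ = 1 - ‖a‖ ^ 2 := by
    rw [Complex.conj_mul', ← Complex.ofReal_one, ← Complex.ofReal_pow, ← Complex.ofReal_sub,
      Complex.norm_real, Real.norm_of_nonneg h4.le]
  rw [diskPoisson, diskPoisson, one_sub_norm_diskAut_sq ha hz.le,
    diskAut_sub_diskAut ha hσ.le hz.le, norm_div, norm_mul, norm_mul, h5,
    ← norm_one_sub_conj_mul_sq (a := a) hσ]
  generalize ‖1 - conj a * z‖ = x at *
  generalize ‖1 - conj a * σ‖ = y at *
  field_simp

/-- Identifies the factor in the theorem as the ratio of the conformal factors at `σ` and `τ`. -/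
theorem one_add_two_mul_re_eq {a σ τ : ℂ} (ha : ‖a‖ < 1) (hσ : ‖σ‖ = 1) (hτ : ‖τ‖ = 1) :
    1 + 2 * ((τ - σ) * conj a / ((‖τ - a‖ ^ 2 : ℝ) : ℂ)).re =
      ‖σ - a‖ ^ 2 / ‖τ - a‖ ^ 2 := by
  have h : 0 < ‖τ - a‖ ^ 2 := pow_pos (norm_pos_iff.mpr (sub_ne_zero_of_norm hτ ha)) 2
  have e : ‖σ - a‖ ^ 2 - ‖τ - a‖ ^ 2 = 2 * ((τ - σ) * conj a).re := by
    have h1 : ‖σ‖ ^ 2 = ‖τ‖ ^ 2 := by rw [hσ, hτ]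
    simp only [Complex.sq_norm, Complex.normSq_apply, Complex.sub_re, Complex.sub_im,
      Complex.mul_re, Complex.conj_re, Complex.conj_im] at h1 ⊢
    linear_combination h1
  rw [Complex.div_ofReal_re, eq_div_iff h.ne', add_mul, mul_assoc, div_mul_cancel₀ _ h.ne']
  linarith

theorem tendsto_one_sub_pow_div (k : ℕ) :
    Tendsto (fun r : ℝ => (1 - (r : ℂ) ^ k) / (1 - r)) (𝓝[<] 1) (𝓝 k) := by
  have hc : Continuous fun r : ℝ => ∑ i ∈ Finset.range k, (r : ℂ) ^ i := by fun_prop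
  have := (hc.tendsto 1).mono_left (nhdsWithin_le_nhds (s := Set.Iio 1))
  simp only [Complex.ofReal_one, one_pow, Finset.sum_const, Finset.card_range, nsmul_eq_mul,
    mul_one] at this
  refine this.congr' ?_
  filter_upwards [eventually_Ioo_zero_one] with r hr
  have hr1 : (1 - r : ℂ) ≠ 0 := by exact_mod_cast (by linarith [hr.2] : (1 - r : ℝ) ≠ 0)
  rw [eq_div_iff hr1]
  exact geom_sum_mul_neg _ _

/-- If `b` is the dilation coefficient of `w ^ k * h w` at a boundary point `ζ` where this function
takes the value `ζ ^ k`, then that of `h` at `ζ` is `b - k`. -/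
theorem tendsto_of_dilation_pow_mul {h : ℂ → ℂ} (hh : DifferentiableOn ℂ h (ball 0 1))
    (hmaps : Set.MapsTo h (ball 0 1) (ball 0 1)) {k : ℕ} {ζ : ℂ} (hζ : ‖ζ‖ = 1) {b : ℝ}
    (hb : 0 < b)
    (hle : ∀ w ∈ ball (0 : ℂ) 1, diskPoisson ζ w ≤ b * diskPoisson (ζ ^ k) (w ^ k * h w))
    (hinf : ∀ b' < b, ∃ w ∈ ball (0 : ℂ) 1,
      b' * diskPoisson (ζ ^ k) (w ^ k * h w) < diskPoisson ζ w) :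
    0 < b - k ∧ Tendsto (fun r : ℝ => (1 - r : ℂ) / (1 - h (r * ζ))) (𝓝[<] 1)
      (𝓝 ((1 / (b - k) : ℝ) : ℂ)) := by
  have hlt : ∀ z, ‖z‖ < 1 → ‖h z‖ < 1 := fun z hz => by
    simpa using hmaps (mem_ball_zero_iff.mpr hz)
  have hsub : ∀ z, ‖z‖ < 1 → 1 - h z ≠ 0 := fun z hz =>
    sub_ne_zero_of_norm (by simp) (hlt z hz)
  have hηn : ‖ζ ^ k‖ = 1 := by rw [norm_pow, hζ, one_pow]
  have hη0 : ζ ^ k ≠ 0 := by intro h0; rw [h0] at hηn; simp at hηn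
  have hglt : ∀ z, ‖z‖ < 1 → ‖z ^ k * h z‖ < 1 := by
    intro z hz
    rw [norm_mul, norm_pow]
    have h1 : ‖z‖ ^ k ≤ 1 := pow_le_one₀ (norm_nonneg z) hz.le
    nlinarith [hlt z hz, norm_nonneg (h z)]
  have hgsub : ∀ z, ‖z‖ < 1 → ζ ^ k - z ^ k * h z ≠ 0 := fun z hz =>
    sub_ne_zero_of_norm hηn (hglt z hz)
  have hone_sub : Tendsto (fun r : ℝ => (1 - r : ℂ)) (𝓝[<] 1) (𝓝 0) := by
    have : Continuous fun r : ℝ => (1 - r : ℂ) := by fun_prop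
    simpa using (this.tendsto 1).mono_left nhdsWithin_le_nhds
  have hone_ne : ∀ᶠ r : ℝ in 𝓝[<] 1, (1 - r : ℂ) ≠ 0 := by
    filter_upwards [eventually_Ioo_zero_one] with r hr
    exact_mod_cast (by linarith [hr.2] : (1 - r : ℝ) ≠ 0)
  have hgd : DifferentiableOn ℂ (fun w => w ^ k * h w) (ball 0 1) :=
    DifferentiableOn.mul (by fun_prop) hh
  -- The real part of this function is the Poisson kernel at the image point, so its optimal
  -- constant at `ζ` is `1 / b`.
  have hG := tendsto_one_sub_mul_of_isGLB (F := fun w => herglotz (ζ ^ k) (w ^ k * h w))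
    (c := 1 / b)
    ((hgd.const_add _).div (hgd.const_sub _) fun z hz => hgsub z (by simpa using hz)) hζ
    (fun z hz => by
      rw [herglotz_re hηn, one_div_mul_eq_div, div_le_iff₀ hb, mul_comm]
      exact hle z hz)
    (fun c' hc' => by
      have hc0 : 0 < c' := lt_trans (by positivity) hc'
      obtain ⟨w, hw, hlt⟩ := hinf (1 / c') (by
        rw [gt_iff_lt, div_lt_iff₀ hb] at hc'
        rw [div_lt_iff₀ hc0]; linarith)
      refine ⟨w, hw, ?_⟩
      rw [herglotz_re hηn]
      rw [one_div_mul_eq_div, div_lt_iff₀ hc0] at hlt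
      linarith)
  have hG2 : Tendsto (fun r : ℝ => (1 - (r : ℂ) ^ k * h (r * ζ)) / (1 - r)) (𝓝[<] 1) (𝓝 b) := by
    have h2 : (2 * ((1 / b : ℝ) : ℂ)) ≠ 0 := by
      simpa using hb.ne'
    have := ((hG.add hone_sub).inv₀ (by simpa using h2)).const_mul 2
    have e : 2 * (2 * ((1 / b : ℝ) : ℂ) + 0)⁻¹ = b := by
      have : (b : ℂ) ≠ 0 := by exact_mod_cast hb.ne'
      push_cast; field_simp; ring
    rw [e] at this
    refine this.congr' ?_
    filter_upwards [eventually_Ioo_zero_one, hone_ne] with r hr hr1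
    have hs := hgsub _ (norm_ofReal_mul_lt_one hζ hr)
    have e1 : ζ ^ k - (r * ζ) ^ k * h (r * ζ) = ζ ^ k * (1 - r ^ k * h (r * ζ)) := by
      rw [mul_pow]; ring
    have e2 : ζ ^ k + (r * ζ) ^ k * h (r * ζ) = ζ ^ k * (1 + r ^ k * h (r * ζ)) := by
      rw [mul_pow]; ring
    rw [e1] at hs
    have hs' := right_ne_zero_of_mul hs
    rw [herglotz, e1, e2, mul_div_mul_left _ _ hη0]
    have e3 : (1 - r : ℂ) * ((1 + r ^ k * h (r * ζ)) / (1 - r ^ k * h (r * ζ))) + (1 - r) =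
        2 * ((1 - r) / (1 - r ^ k * h (r * ζ))) := by
      field_simp; ring
    rw [e3, mul_inv, inv_div, mul_inv_cancel_left₀ two_ne_zero]
  -- Use `r ^ k * (1 - h) = (1 - r ^ k * h) - (1 - r ^ k)`; the last term accounts for `k`.
  have hG3 : Tendsto (fun r : ℝ => (1 - h (r * ζ)) / (1 - r : ℂ)) (𝓝[<] 1) (𝓝 (b - k)) := by
    have hp : Tendsto (fun r : ℝ => (r : ℂ) ^ k) (𝓝[<] 1) (𝓝 1) := by
      have : Continuous fun r : ℝ => (r : ℂ) ^ k := by fun_prop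
      simpa using (this.tendsto 1).mono_left nhdsWithin_le_nhds
    have := (hG2.sub (tendsto_one_sub_pow_div k)).div hp one_ne_zero
    rw [div_one] at this
    refine this.congr' ?_
    filter_upwards [eventually_Ioo_zero_one, hone_ne] with r hr hr1
    have hr0 : (r : ℂ) ^ k ≠ 0 := pow_ne_zero _ (by exact_mod_cast hr.1.ne')
    simp only [Pi.div_apply]
    field_simp
    ring
  -- So far `b - k` could be zero or negative. The Cayley transform of `h` shows that the reciprocal
  -- quotient has a finite limit `c ≥ 0`, and `c * (b - k) = 1` then forces `b - k > 0`.
  obtain ⟨c, hc0, -, hcl⟩ := exists_tendsto_one_sub_mul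
    (F := fun z => (1 + h z) / (1 - h z)) ((hh.const_add _).div (hh.const_sub _)
      fun z hz => hsub z (by simpa using hz))
    (fun z hz => by
      rw [cayley_re]
      have := hlt z (by simpa using hz)
      exact div_nonneg (by nlinarith [norm_nonneg (h z)]) (sq_nonneg _)) hζ
  have hcl2 : Tendsto (fun r : ℝ => (1 - r : ℂ) / (1 - h (r * ζ))) (𝓝[<] 1) (𝓝 c) := by
    have := (hcl.add hone_sub).const_mul (1 / 2)
    rw [show (1 / 2 : ℂ) * (2 * c + 0) = c by ring] at this
    refine this.congr' ?_
    filter_upwards [eventually_Ioo_zero_one] with r hr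
    have := hsub _ (norm_ofReal_mul_lt_one hζ hr)
    field_simp
    ring
  have hprod : (c : ℂ) * (b - k) = 1 := by
    refine tendsto_nhds_unique (hcl2.mul hG3) (tendsto_const_nhds.congr' ?_)
    filter_upwards [eventually_Ioo_zero_one, hone_ne] with r hr hr1
    have := hsub _ (norm_ofReal_mul_lt_one hζ hr)
    field_simp
  have hprod' : c * (b - k) = 1 := by exact_mod_cast hprod
  have hpos : 0 < b - k := by
    by_contra! hneg
    nlinarith
  refine ⟨hpos, ?_⟩
  rwa [← eq_div_of_mul_eq hpos.ne' hprod']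

end FixedPoint

/-! ### Assembly of the theorem. -/

theorem theorem3p9
    (f : ℂ → ℂ) (hf : DifferentiableOn ℂ f (Metric.ball 0 1))
    (hmaps : Set.MapsTo f (Metric.ball 0 1) (Metric.ball 0 1))
    (k : ℕ) (hk : 1 ≤ k) (hB : ∀ d ≤ k, ¬ IsBlaschkeProduct d f)
    (z₀ : ℂ) (hz₀ : z₀ ∈ Metric.ball (0 : ℂ) 1) (hfix : f z₀ = z₀)
    (hder : ∀ i, 1 ≤ i → i < k → iteratedDeriv i f z₀ = 0)
    (n : ℕ) (σ τ : Fin n → ℂ) (hσ : ∀ j, σ j ∈ Metric.sphere (0 : ℂ) 1)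
    (hinj : Function.Injective σ)
    (hβ : ∀ j, boundaryDilation f (σ j) < ⊤)
    (hlim : ∀ j, HasNontangentialLimit f (σ j) (τ j))
    (hτ : ∀ j, τ j =
      (((σ j - z₀) / (1 - (starRingEnd ℂ) z₀ * σ j)) ^ k + z₀) /
        (1 + (starRingEnd ℂ) z₀ * ((σ j - z₀) / (1 - (starRingEnd ℂ) z₀ * σ j)) ^ k)) :
    (∀ j, 0 < (1 + 2 * ((τ j - σ j) * (starRingEnd ℂ) z₀ / ((‖τ j - z₀‖ ^ 2 : ℝ) : ℂ)).re) *
        (boundaryDilation f (σ j)).toReal - k) ∧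
    iteratedDeriv k f z₀ / (k.factorial : ℂ) * (1 - (‖z₀‖ : ℂ) ^ 2) ^ (k - 1) ≠ 1 ∧
    ∑ j, 1 / ((1 + 2 * ((τ j - σ j) * (starRingEnd ℂ) z₀ / ((‖τ j - z₀‖ ^ 2 : ℝ) : ℂ)).re) *
        (boundaryDilation f (σ j)).toReal - k) ≤
      (1 - ‖iteratedDeriv k f z₀ / (k.factorial : ℂ) * (1 - (‖z₀‖ : ℂ) ^ 2) ^ (k - 1)‖ ^ 2) /
        ‖1 - iteratedDeriv k f z₀ / (k.factorial : ℂ) * (1 - (‖z₀‖ : ℂ) ^ 2) ^ (k - 1)‖ ^ 2 ∧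
    (∑ j, 1 / ((1 + 2 * ((τ j - σ j) * (starRingEnd ℂ) z₀ / ((‖τ j - z₀‖ ^ 2 : ℝ) : ℂ)).re) *
        (boundaryDilation f (σ j)).toReal - k) =
      (1 - ‖iteratedDeriv k f z₀ / (k.factorial : ℂ) * (1 - (‖z₀‖ : ℂ) ^ 2) ^ (k - 1)‖ ^ 2) /
        ‖1 - iteratedDeriv k f z₀ / (k.factorial : ℂ) * (1 - (‖z₀‖ : ℂ) ^ 2) ^ (k - 1)‖ ^ 2 ↔
      IsBlaschkeProduct (n + k) f) := by
  have hz : ‖z₀‖ < 1 := by simpa using hz₀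
  have hz' : ‖-z₀‖ < 1 := by simpa using hz
  have hσ1 : ∀ j, ‖σ j‖ = 1 := fun j => by simpa using hσ j
  set ζ : Fin n → ℂ := fun j => diskAut z₀ (σ j) with hζdef
  have hζ : ∀ j, ‖ζ j‖ = 1 := fun j => norm_diskAut_eq_one hz (hσ1 j)
  have hζk : ∀ j, ‖ζ j ^ k‖ = 1 := fun j => by rw [norm_pow, hζ, one_pow]
  have hζinj : Function.Injective ζ := by
    intro i j hij
    have := congrArg (diskAut (-z₀)) hij
    simp only [hζdef] at this
    rw [diskAut_neg_diskAut hz (hσ1 i).le, diskAut_neg_diskAut hz (hσ1 j).le] at this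
    exact hinj this
  -- The prescribed boundary value says that the conjugated map agrees with `w ^ k` at `ζ j`.
  have hτζ : ∀ j, τ j = diskAut (-z₀) (ζ j ^ k) := fun j => by
    rw [hτ j]; simp [hζdef, diskAut]
  have hτ1 : ∀ j, ‖τ j‖ = 1 := fun j => by
    rw [hτζ]; exact norm_diskAut_eq_one hz' (hζk j)
  have hφτ : ∀ j, diskAut z₀ (τ j) = ζ j ^ k := fun j => by
    rw [hτζ, diskAut_diskAut_neg hz (hζk j).le]
  have hfn : ∀ z, ‖z‖ < 1 → ‖f z‖ < 1 := fun z hz => by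
    simpa using hmaps (mem_ball_zero_iff.mpr hz)
  obtain ⟨h, hh, hhmaps, hgh, hh0⟩ :=
    exists_conj_eq_pow_mul hf hmaps hk (hB k le_rfl) hz hfix hder
  have hβeq : ∀ j, boundaryDilation f (σ j) = dilationCoeffAt f (σ j) (τ j) := fun j =>
    boundaryDilation_eq_dilationCoeffAt hmaps (hσ1 j) (hτ1 j) (hlim j)
  have hm : 0 < 1 - ‖z₀‖ ^ 2 := by nlinarith [norm_nonneg z₀]
  have hs : ∀ {p : ℂ}, ‖p‖ = 1 → 0 < ‖p - z₀‖ ^ 2 := fun hp =>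
    pow_pos (norm_pos_iff.mpr (sub_ne_zero_of_norm hp hz)) 2
  have hPζ : ∀ j z, ‖z‖ < 1 → diskPoisson (ζ j) (diskAut z₀ z) =
      diskPoisson (σ j) z * (‖σ j - z₀‖ ^ 2 / (1 - ‖z₀‖ ^ 2)) := fun j z hzz =>
    diskPoisson_diskAut hz (hσ1 j) hzz
  have hPη : ∀ j z, ‖z‖ < 1 → diskPoisson (ζ j ^ k) (diskAut z₀ z ^ k * h (diskAut z₀ z)) =
      diskPoisson (τ j) (f z) * (‖τ j - z₀‖ ^ 2 / (1 - ‖z₀‖ ^ 2)) := fun j z hzz => by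
    rw [← hgh _ (norm_diskAut_lt_one hz hzz), diskAut_neg_diskAut hz hzz.le, ← hφτ,
      diskPoisson_diskAut hz (hτ1 j) (hfn z hzz)]
  have key : ∀ j, 0 < ‖σ j - z₀‖ ^ 2 / ‖τ j - z₀‖ ^ 2 * (boundaryDilation f (σ j)).toReal - k ∧
      Filter.Tendsto (fun r : ℝ => (1 - r : ℂ) / (1 - h (r * ζ j))) (nhdsWithin 1 (Set.Iio 1))
        (nhds ((1 / (‖σ j - z₀‖ ^ 2 / ‖τ j - z₀‖ ^ 2 * (boundaryDilation f (σ j)).toReal - k) :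
          ℝ) : ℂ)) := by
    intro j
    have hS := hs (hσ1 j)
    have hT := hs (hτ1 j)
    have hS' : ‖σ j - z₀‖ ≠ 0 := (pow_ne_zero_iff two_ne_zero).mp hS.ne'
    have hT' : ‖τ j - z₀‖ ≠ 0 := (pow_ne_zero_iff two_ne_zero).mp hT.ne'
    have hfin : dilationCoeffAt f (σ j) (τ j) ≠ ⊤ := hβeq j ▸ (hβ j).ne
    rw [hβeq j]
    set b := (dilationCoeffAt f (σ j) (τ j)).toReal with hb
    have hub : ∀ z ∈ Metric.ball (0 : ℂ) 1, diskPoisson (σ j) z ≤ b * diskPoisson (τ j) (f z) :=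
      fun z hz => diskPoisson_le_of_dilationCoeffAt hmaps (hτ1 j) hfin hz
    have hb0 : 0 < b := by
      have h1 := hub 0 (by simp)
      have h2 := diskPoisson_pos (z := 0) (hσ1 j) (by simp)
      exact pos_of_mul_pos_left (h2.trans_le h1)
        (diskPoisson_pos (hτ1 j) (hfn 0 (by simp))).le
    refine tendsto_of_dilation_pow_mul hh hhmaps (hζ j) (by positivity) (fun w hw => ?_)
      (fun b' hb' => ?_)
    · rw [mem_ball_zero_iff] at hw
      have hw' := norm_diskAut_lt_one hz' hw
      have h1 := hub _ (mem_ball_zero_iff.mpr hw')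
      rw [← diskAut_diskAut_neg hz hw.le, hPζ j _ hw', hPη j _ hw']
      calc _ ≤ b * diskPoisson (τ j) (f (diskAut (-z₀) w)) *
            (‖σ j - z₀‖ ^ 2 / (1 - ‖z₀‖ ^ 2)) := by gcongr
        _ = _ := by field_simp
    -- Near-optimality for `f` is tested at `b'` with the ratio of conformal factors undone.
    · obtain ⟨z, hzb, hlt⟩ := exists_lt_diskPoisson_of_lt_dilationCoeffAt hmaps (hσ1 j) (hτ1 j)
        (b := b' * (‖τ j - z₀‖ ^ 2 / ‖σ j - z₀‖ ^ 2)) (by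
          rw [div_mul_eq_mul_div, lt_div_iff₀ hT] at hb'
          rw [← mul_div_assoc, div_lt_iff₀ hS]
          linarith)
      have hzb' : ‖z‖ < 1 := by simpa using hzb
      refine ⟨diskAut z₀ z, mapsTo_diskAut hz hzb, ?_⟩
      rw [hPζ j _ hzb', hPη j _ hzb']
      calc _ = b' * (‖τ j - z₀‖ ^ 2 / ‖σ j - z₀‖ ^ 2) * diskPoisson (τ j) (f z) *
            (‖σ j - z₀‖ ^ 2 / (1 - ‖z₀‖ ^ 2)) := by field_simp
        _ < _ := by gcongr
  have hmain := sum_boundary_le hh hhmaps hζ hζinj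
    (fun j => one_div_pos.mpr (key j).1) (fun j => (key j).2)
  rw [hh0] at hmain
  simp only [one_add_two_mul_re_eq hz (hσ1 _) (hτ1 _)]
  refine ⟨fun j => (key j).1, fun h1 => ?_, hmain.1, hmain.2.trans ?_⟩
  · have : ‖h 0‖ < 1 := by simpa using hhmaps (Metric.mem_ball_self one_pos)
    rw [hh0, h1] at this
    simp at this
  · have hc : ContinuousAt h 0 :=
      (hh.differentiableAt (Metric.ball_mem_nhds _ one_pos)).continuousAt
    rw [← isBlaschkeProduct_pow_mul_iff k hc, ← isBlaschkeProduct_conj_iff hz hmaps]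
    exact ⟨fun H => H.congr hgh, fun H => H.congr fun z hz => (hgh z hz).symm⟩
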